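/- Let $k\ge 1$ and let $\Lambda$ be a finite, strongly connected $k$-graph: a countable small category with a degree functor $d:\Lambda\to\mathbb N^k$ having the unique factorization property, such that $\Lambda^n=d^{-1}(n)$ is finite for every $n\in\mathbb N^k$ and such that for all vertices $v,w$ there is a morphism with range $v$ and source $w$. For $1\le i\le k$ let $A_i(v,w)$ be the number of morphisms of degree $e_i$ with range $v$ and source $w$, let $\rho_i$ be the spectral radius of the matrix $A_i$, and let $x^\Lambda\in(0,\infty)^{\Lambda^0}$ be the Perron–Frobenius eigenvector of $\Lambda$, i.e. the unique positive vector with $\sum_v x^\Lambda_v=1$ and $A_ix^\Lambda=\rho_ix^\Lambda$ for all $i$. Let $\mathcal B_\Lambda$ be the stationary $k$-Bratteli diagram of $A_1,\dots,A_k$: each vertex set $\mathcal V_n$ ($n\ge 0$) is a copy of $\Lambda^0$, and for $n\ge 1$ with $n\equiv i \pmod k$, $1\le i\le k$, there are $A_i(p,q)$ edges with range $p\in\mathcal V_{n-1}$ and source $q\in\mathcal V_n$. Let $X_{\mathcal B_\Lambda}$ be its space of infinite paths starting at level $0$, $F\mathcal B_\Lambda$ the set of its finite paths with range in $\mathcal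 V_0$ (vertices of $\mathcal V_0$ being the paths of length $0$), and $[\lambda]\subseteq X_{\mathcal B_\Lambda}$ the cylinder set of $\lambda\in F\mathcal B_\Lambda$; $X_{\mathcal B_\Lambda}$ carries the topology generated by the cylinder sets. Fix $\delta\in(0,1)$, and for $\eta\in F\mathcal B_\Lambda$ of length $qk+t$, $0\le t<k$, with source $s(\eta)$, put $$w_\delta(\eta)=\left(\rho_1^{q+1}\cdots\rho_t^{q+1}\rho_{t+1}^{q}\cdots\rho_k^{q}\right)^{-1/\delta}x^\Lambda_{s(\eta)} .$$ Define $d_\delta(x,x)=0$ and, for distinct $x,y\in X_{\mathcal B_\Lambda}$, $d_\delta(x,y)=1$ if $x,y$ have different ranges and $d_\delta(x,y)=w_\delta(x\wedge y)$ otherwise, where $x\wedge y$ is the longest common initial path of $x$ and $y$. Assume that $w_\delta(\lambda)=\operatorname{diam}[\lambda]:=\sup\{d_\delta(x,y):x,y\in[\lambda]\}$ for all $\lambda\in F\mathcal B_\Lambda$. A choice function is a map $\tau=(\tau_+,\tau_-):F\mathcal B_\Lambda\to X_{\mathcal B_\Lambda}\times X_{\mathcal B_\Lambda}$ with $\tau_\pm(\gamma)\in[\gamma]$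 and $d_\delta(\tau_+(\gamma),\tau_-(\gamma))=\operatorname{diam}[\gamma]$ for all $\gamma$. On $\ell^2(F\mathcal B_\Lambda,\mathbb C^2)$ let $$\pi_\tau(f)=\bigoplus_{\gamma\in F\mathcal B_\Lambda}\begin{pmatrix} f(\tau_+(\gamma))&0\\0&f(\tau_-(\gamma))\end{pmatrix},\qquad D=\bigoplus_{\gamma\in F\mathcal B_\Lambda}\frac1{\operatorname{diam}[\gamma]}\begin{pmatrix}0&1\\1&0\end{pmatrix}.$$ Then for every choice function $\tau$ and every $\lambda\in F\mathcal B_\Lambda$ the limit $$\mu_\delta([\lambda])=\lim_{s\searrow1}(s-1)\operatorname{Tr}\left(\left(\pi_\tau(\chi_{[\lambda]})|D|^{-\delta}\right)^s\right)$$ exists and is finite, it does not depend on $\tau$, and the assignment $[\lambda]\mapsto\mu_\delta([\lambda])$, $\lambda\in F\mathcal B_\Lambda$, extends uniquely to a finite Borel measure on $X_{\mathcal B_\Lambda}$. In particular this measure is independent of the choice function $\tau$. -/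

import Mathlib

open CategoryTheory Filter Topology MeasureTheory
open scoped ENNReal InnerProductSpace ComplexOrder

universe u v

noncomputable section

/-! ## Bratteli diagrams, path spaces and ultrametrics -/

/-- A Bratteli diagram. `E n` is the finite set of edges whose source is in `V (n + 1)` and whose
range is in `V n` (so the edge set usually called `𝓔ₙ₊₁`). -/
structure BratteliDiagram where
  V : ℕ → Type u
  E : ℕ → Type u
  finite_V : ∀ n, Finite (V n)
  finite_E : ∀ n, Finite (E n)
  r : ∀ {n}, E n → V n
  s : ∀ {n}, E n → V (n + 1)

namespace BratteliDiagram

variable (B : BratteliDiagram.{u})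

/-- The infinite path space `X_B`. -/
def InfPath : Type u :=
  {x : ∀ n, B.E n // ∀ n, B.s (x n) = B.r (x (n + 1))}

/-- Finite paths of length `n` with range in `V 0`. A path of length `0` is a vertex of `V 0`;
a path of positive length is its sequence of edges (the field `root` is then determined). -/
structure FinPath (n : ℕ) where
  /-- the range of the path -/
  root : B.V 0
  edge : ∀ i : Fin n, B.E i
  root_eq : ∀ h : 0 < n, B.r (edge ⟨0, h⟩) = root
  compat : ∀ (i : ℕ) (h : i + 1 < n),
    B.s (edge ⟨i, Nat.lt_of_succ_lt h⟩) = B.r (edge ⟨i + 1, h⟩)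

/-- `FB`: all finite paths with range in `V 0`; the first component is the length. -/
abbrev Paths : Type u := Σ n, B.FinPath n

variable {B}

/-- The source of a finite path. -/
def FinPath.source : {n : ℕ} → B.FinPath n → B.V n
  | 0, p => p.root
  | n + 1, p => B.s (p.edge (Fin.last n))

/-- The range of an infinite path. -/
def InfPath.range (x : B.InfPath) : B.V 0 := B.r (x.1 0)

/-- The sub-path consisting of the first `n` edges of an infinite path. -/
def InfPath.take (x : B.InfPath) (n : ℕ) : B.FinPath n where
  root := x.range
  edge := fun i => x.1 i
  root_eq := fun _ => rfl
  compat := fun i _ => x.2 i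

/-- The cylinder set `[η]`: infinite paths that have `η` as a sub-path. For a vertex `v` of
`V 0` this is the set of infinite paths with range `v`. -/
def cylinder (η : B.Paths) : Set B.InfPath := {x | x.take η.1 = η.2}

/-- The topology generated by the cylinder sets. -/
instance : TopologicalSpace B.InfPath :=
  TopologicalSpace.generateFrom (Set.range (cylinder (B := B)))

instance : MeasurableSpace B.InfPath := borel _

instance : BorelSpace B.InfPath := ⟨rfl⟩

theorem isClopen_cylinder (η : B.Paths) : IsClopen (cylinder η) := by
  have ho : ∀ ξ : B.Paths, IsOpen (cylinder ξ) := fun ξ =>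
    TopologicalSpace.isOpen_generateFrom_of_mem ⟨ξ, rfl⟩
  refine ⟨⟨?_⟩, ho η⟩
  have h : (cylinder η)ᶜ = ⋃ ξ : {ξ : B.FinPath η.1 // ξ ≠ η.2}, cylinder ⟨η.1, ξ.1⟩ := by
    ext x
    simp only [cylinder, Set.mem_compl_iff, Set.mem_iUnion, Set.mem_ofPred_eq]
    exact ⟨fun hx => ⟨⟨_, hx⟩, rfl⟩, fun ⟨ξ, hξ⟩ hx => ξ.2 (hξ.symm.trans hx)⟩
  rw [h]
  exact isOpen_iUnion fun ξ => ho _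

/-- The characteristic function `χ_[η]` as a (bounded, continuous) function on `X_B`. -/
def cylinderChar (η : B.Paths) : BoundedContinuousFunction B.InfPath ℂ :=
  BoundedContinuousFunction.ofNormedAddCommGroup ((cylinder η).indicator fun _ => (1 : ℂ))
    (continuous_indicator (by simp [(isClopen_cylinder η).frontier_eq])
      continuous_const.continuousOn) 1 fun x => by
      by_cases hx : x ∈ cylinder η <;> simp [hx]

/-- The length of `x ∧ y`, the longest common sub-path of two distinct infinite paths with the
same range: the first position at which the two edge sequences differ. -/
def meetLength (x y : B.InfPath) : ℕ := sInf {n | x.1 n ≠ y.1 n}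

open Classical in
/-- The function `d_w` on `X_B` attached to a function `w` on finite paths. -/
def dist (w : B.Paths → ℝ) (x y : B.InfPath) : ℝ :=
  if x = y then 0
  else if x.range = y.range then w ⟨meetLength x y, x.take (meetLength x y)⟩
  else 1

/-- The diameter of the cylinder set `[η]` with respect to `d_w`. -/
def diam (w : B.Paths → ℝ) (η : B.Paths) : ℝ :=
  sSup {t | ∃ x ∈ cylinder η, ∃ y ∈ cylinder η, t = dist w x y}

/-- Choice functions `τ = (τ₊, τ₋)` for `(X_B, d_w)`. -/
structure ChoiceFunction (w : B.Paths → ℝ) where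
  plus : B.Paths → B.InfPath
  minus : B.Paths → B.InfPath
  plus_mem : ∀ γ, plus γ ∈ cylinder γ
  minus_mem : ∀ γ, minus γ ∈ cylinder γ
  dist_eq : ∀ γ, dist w (plus γ) (minus γ) = diam w γ

end BratteliDiagram

/-! ## Operators on `ℓ²(ι, ℂ²)` and more general Hilbert spaces -/

/-- The Hilbert space `ℓ²(ι, ℂ²)`. -/
abbrev L2C2 (ι : Type u) : Type u := lp (fun _ : ι => EuclideanSpace ℂ (Fin 2)) 2

/-- The orthogonal direct sum of `2 × 2` matrices as a possibly unbounded operator on `ℓ²(ι, ℂ²)`,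
on its maximal domain. -/
def blockDiag {ι : Type u} (a : ι → Matrix (Fin 2) (Fin 2) ℂ) : L2C2 ι →ₗ.[ℂ] L2C2 ι where
  domain :=
    { carrier := {ψ | Memℓp (fun γ => Matrix.toEuclideanCLM (𝕜 := ℂ) (a γ) (ψ γ)) 2}
      zero_mem' := by
        have h : Memℓp (0 : ι → EuclideanSpace ℂ (Fin 2)) 2 := zero_memℓp
        refine cast (congrArg (fun f => Memℓp f 2) ?_) h
        funext γ
        simp
      add_mem' := by
        intro ψ φ hψ hφ
        refine cast (congrArg (fun f => Memℓp f 2) ?_) (Memℓp.add hψ hφ)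
        funext γ
        simp
      smul_mem' := by
        intro c ψ hψ
        refine cast (congrArg (fun f => Memℓp f 2) ?_) (Memℓp.const_smul hψ c)
        funext γ
        simp }
  toFun :=
    { toFun := fun ψ => ⟨fun γ => Matrix.toEuclideanCLM (𝕜 := ℂ) (a γ) (ψ.1 γ), ψ.2⟩
      map_add' := by
        intro ψ φ
        ext1
        funext γ
        exact map_add _ _ _
      map_smul' := by
        intro c ψ
        ext1
        funext γ
        exact map_smul (Matrix.toEuclideanCLM (𝕜 := ℂ) (a γ)) c (ψ.1 γ) }

/-- The orthonormal basis `δ_γ ⊗ e_i` of `ℓ²(ι, ℂ²)`. -/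
def stdBasis (ι : Type u) : HilbertBasis (ι × Fin 2) ℂ (L2C2 ι) := by
  classical
  exact HilbertBasis.mkOfOrthogonalEqBot
    (v := fun p : ι × Fin 2 => lp.single 2 p.1 (EuclideanSpace.single p.2 (1 : ℂ)))
    (by
      rw [orthonormal_iff_ite]
      rintro ⟨γ, i⟩ ⟨γ', i'⟩
      rw [lp.inner_single_left, lp.single_apply]
      by_cases h : γ = γ'
      · subst h
        simp [EuclideanSpace.inner_single_left]
      · simp [h])
    (by
      rw [Submodule.eq_bot_iff]
      intro ψ hψ
      rw [Submodule.mem_orthogonal] at hψ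
      ext1
      funext γ
      ext i
      have := hψ _ (Submodule.subset_span ⟨(γ, i), rfl⟩)
      rw [lp.inner_single_left, EuclideanSpace.inner_single_left] at this
      simpa using this)

theorem stdBasis_apply {ι : Type u} [DecidableEq ι] (p : ι × Fin 2) :
    stdBasis ι p = lp.single 2 p.1 (EuclideanSpace.single p.2 (1 : ℂ)) := by
  rw [stdBasis, HilbertBasis.coe_mkOfOrthogonalEqBot]
  congr 1
  exact Subsingleton.elim _ _

section Hilbert

variable {H : Type u} [NormedAddCommGroup H] [InnerProductSpace ℂ H] [CompleteSpace H]

open Classical in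
/-- The bounded inverse of a possibly unbounded operator `D`: the unique bounded operator `R` with
range in the domain of `D`, `D R = 1` and `R D = 1` on the domain of `D` (and `0` if there is
none). -/
def boundedInverse (D : H →ₗ.[ℂ] H) : H →L[ℂ] H :=
  if h : ∃ R : H →L[ℂ] H, (∀ ψ, ∃ hψ : R ψ ∈ D.domain, D ⟨R ψ, hψ⟩ = ψ) ∧
      ∀ φ : D.domain, R (D φ) = φ
  then h.choose else 0

/-- `|D|^{-t}` for an invertible self-adjoint operator `D` and `t > 0`. Here `|D|⁻¹ = |D⁻¹|`, and
the absolute value and the power are those of the continuous functional calculus. -/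
def absNegPow (D : H →ₗ.[ℂ] H) (t : ℝ) : H →L[ℂ] H := CFC.abs (boundedInverse D) ^ t

/-- The trace, with values in `[0, ∞]`, of a positive operator `T`, computed in a given
orthonormal basis (on which it does not depend). -/
def posTrace {κ : Type*} (b : HilbertBasis κ ℂ H) (T : H →L[ℂ] H) : ℝ≥0∞ :=
  ∑' j, ENNReal.ofReal (⟪b j, T (b j)⟫_ℂ).re

/-- `lim_{s ↘ 1} (s - 1) Tr (T ^ s) = t`, the limit being taken in `[0, ∞]`, and `T ^ s` being
given by the continuous functional calculus of the positive operator `T`. -/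
def HasResidueTrace {κ : Type*} (b : HilbertBasis κ ℂ H) (T : H →L[ℂ] H) (t : ℝ≥0∞) : Prop :=
  Tendsto (fun s : ℝ => ENNReal.ofReal (s - 1) * posTrace b (T ^ s)) (𝓝[>] 1) (𝓝 t)

end Hilbert

/-! ## The Pearson--Bellissard representation and Dirac operator -/

namespace BratteliDiagram

variable {B : BratteliDiagram.{u}}

/-- The Dirac operator `D = ⨁_γ (1 / diam [γ]) (0 1; 1 0)` on `ℓ²(FB, ℂ²)`. -/
def dirac (w : B.Paths → ℝ) : L2C2 B.Paths →ₗ.[ℂ] L2C2 B.Paths :=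
  blockDiag fun γ => ((1 / diam w γ : ℝ) : ℂ) • !![0, 1; 1, 0]

theorem norm_rep_le {w : B.Paths → ℝ} (τ : ChoiceFunction w)
    (f : BoundedContinuousFunction B.InfPath ℂ) (γ : B.Paths) :
    ‖Matrix.toEuclideanCLM (𝕜 := ℂ) !![f (τ.plus γ), 0; 0, f (τ.minus γ)]‖ ≤ ‖f‖ := by
  refine ContinuousLinearMap.opNorm_le_bound _ (norm_nonneg f) fun ψ => ?_
  refine abs_le_of_sq_le_sq' ?_ (by positivity) |>.2
  have h0 := f.norm_coe_le_norm (τ.plus γ)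
  have h1 := f.norm_coe_le_norm (τ.minus γ)
  rw [mul_pow, EuclideanSpace.norm_sq_eq, EuclideanSpace.norm_sq_eq]
  simp only [Fin.sum_univ_two, Matrix.ofLp_toEuclideanCLM, Matrix.mulVec, dotProduct,
    Matrix.of_apply, Matrix.cons_val', Matrix.cons_val_zero, Matrix.cons_val_one,
    Matrix.cons_val_fin_one, zero_mul, add_zero, zero_add, norm_mul, mul_pow, mul_add]
  gcongr

/-- The representation `π_τ(f) = ⨁_γ diag (f (τ₊ γ), f (τ₋ γ))` on `ℓ²(FB, ℂ²)`. -/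
def rep {w : B.Paths → ℝ} (τ : ChoiceFunction w) (f : BoundedContinuousFunction B.InfPath ℂ) :
    L2C2 B.Paths →L[ℂ] L2C2 B.Paths :=
  lp.mapCLM 2 (fun γ => Matrix.toEuclideanCLM (𝕜 := ℂ) !![f (τ.plus γ), 0; 0, f (τ.minus γ)])
    (norm_nonneg f) (norm_rep_le τ f)

/-- `lim_{s ↘ 1} (s - 1) Tr ((π_τ(χ_[η]) |D|^{-δ}) ^ s) = t`. -/
def HasDixmierValue {w : B.Paths → ℝ} (τ : ChoiceFunction w) (δ : ℝ) (η : B.Paths)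
    (t : ℝ≥0∞) : Prop :=
  HasResidueTrace (stdBasis B.Paths) (rep τ (cylinderChar η) * absNegPow (dirac w) δ) t

end BratteliDiagram

/-- The stationary `k`-Bratteli diagram of `A 0, …, A (k-1)`: every `V n` is a copy of `ι`, and
there are `A (n mod k) p q` edges with range `p` in `V n` and source `q` in `V (n + 1)`. -/
def stationaryBratteli {k : ℕ} [NeZero k] {ι : Type u} [Finite ι]
    (A : Fin k → Matrix ι ι ℕ) : BratteliDiagram.{u} where
  V _ := ι
  E n := Σ p : ι, Σ q : ι, Fin (A (Fin.ofNat k n) p q)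
  finite_V _ := inferInstance
  finite_E n := by
    have h : ∀ p : ι, Finite (Σ q : ι, Fin (A (Fin.ofNat k n) p q)) := fun p => inferInstance
    exact inferInstanceAs (Finite (Σ p : ι, Σ q : ι, Fin (A (Fin.ofNat k n) p q)))
  r e := e.1
  s e := e.2.1

/-! ## Higher-rank graphs -/

/-- The structure of a `k`-graph on a countable small category. A morphism `λ` with source `v` and
range `w` is an arrow `v ⟶ w`, so that the product `μν` is `ν ≫ μ`. -/
structure HigherRankGraph (k : ℕ) (V : Type u) [Category.{v} V] where
  countable_obj : Countable V
  countable_hom : ∀ x y : V, Countable (x ⟶ y)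
  deg : ∀ {x y : V}, (x ⟶ y) → (Fin k → ℕ)
  deg_id : ∀ x : V, deg (𝟙 x) = 0
  deg_comp : ∀ {x y z : V} (g : x ⟶ y) (f : y ⟶ z), deg (g ≫ f) = deg f + deg g
  factorization : ∀ {x z : V} (f : x ⟶ z) (m n : Fin k → ℕ), deg f = m + n →
    ∃! p : Σ y : V, (x ⟶ y) × (y ⟶ z),
      deg p.2.2 = m ∧ deg p.2.1 = n ∧ p.2.1 ≫ p.2.2 = f

namespace HigherRankGraph

variable {k : ℕ} {V : Type u} [Category.{v} V] (Λ : HigherRankGraph k V)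

/-- `Λ` is finite: each `Λⁿ` is a finite set. -/
def IsFinite : Prop :=
  ∀ n : Fin k → ℕ, Finite {f : Σ x : V, Σ y : V, (x ⟶ y) // Λ.deg f.2.2 = n}

/-- `Λ` is strongly connected: for all vertices `v`, `w` there is a morphism with range `v` and
source `w`. -/
def StronglyConnected (_ : HigherRankGraph k V) : Prop := ∀ v w : V, Nonempty (w ⟶ v)

/-- The `i`-th adjacency matrix: `A i v w` is the number of morphisms of degree `e_i` with range
`v` and source `w`. -/
def adj (i : Fin k) : Matrix V V ℕ :=
  Matrix.of fun v w => Nat.card {f : w ⟶ v // Λ.deg f = Pi.single i 1}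

variable [Fintype V] [DecidableEq V]

/-- The spectral radius `ρ_i` of the `i`-th adjacency matrix. -/
def rho (i : Fin k) : ℝ :=
  (spectralRadius ℂ ((Λ.adj i).map (Nat.cast : ℕ → ℂ))).toReal

/-- The conditions that characterise the Perron--Frobenius eigenvector. -/
def IsPerronFrobenius (x : V → ℝ) : Prop :=
  (∀ v, 0 < x v) ∧ ∑ v, x v = 1 ∧
    ∀ i, ((Λ.adj i).map (Nat.cast : ℕ → ℝ)).mulVec x = Λ.rho i • x

open Classical in
/-- The Perron--Frobenius eigenvector `x^Λ` (it exists and is unique if `Λ` is finite, strongly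
connected and non-empty; the value `0` is used if there is none). -/
def perron : V → ℝ := if h : ∃ x, Λ.IsPerronFrobenius x then h.choose else 0

variable [NeZero k]

/-- The stationary `k`-Bratteli diagram `B_Λ`. -/
def bratteli : BratteliDiagram.{u} := stationaryBratteli Λ.adj

/-- The weight `w_δ` on `FB_Λ`: for a path `η` of length `n = q k + t` with `0 ≤ t < k`, it is
`(ρ₁^{q+1} ⋯ ρ_t^{q+1} ρ_{t+1}^q ⋯ ρ_k^q)^{-1/δ} x^Λ_{s(η)}`. -/
def weight (δ : ℝ) (η : Λ.bratteli.Paths) : ℝ :=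
  (∏ i : Fin k, Λ.rho i ^ (if (i : ℕ) < η.1 % k then η.1 / k + 1 else η.1 / k)) ^ (-1 / δ)
    * Λ.perron (show V from η.2.source)

end HigherRankGraph

end

/-!
The operator `π_τ(χ_[η]) |D|^{-δ}` is diagonal in the standard basis, so `(s - 1)` times the trace
of its `s`-th power is the value at `[η]` of the discrete measure on the path space which gives mass
`(s - 1) diam[γ]^{δ s}` to each of the points `τ₊(γ)` and `τ₋(γ)`. Both points lie in `[γ]`: for
the infinitely many `γ` at least as long as `η` this mass is counted twice or not at all, according
as `γ` extends `η`, whatever `τ` is, and the finitely many shorter `γ` contribute nothing in the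
limit.

The paths extending `η` are counted by products of the matrices `A_i`, which have period `k`. With
`R = ρ₁ ⋯ ρ_k`, the sum over one residue class of lengths modulo `k` is a combination of series
`∑ (R^{1-s})^q a_q`, where `a_q` is a coefficient of `M^q f` for a power-bounded matrix `M`: the
Perron–Frobenius vector is positive and fixed by `M`. The Abel means of such a sequence converge
by the mean ergodic theorem, and `(s - 1) / (1 - R^{1-s})` tends to `1 / log R`. That `R > 1` is
forced by the diameter hypothesis, since a cylinder with a single point has diameter `0`.

The limits on cylinders extend to a measure because every clopen set is compact, so that a finitely
additive function on clopen sets is automatically `σ`-additive.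
-/

noncomputable section

/-! ## Measures as limits on clopen sets -/

theorem isSetRing_isClopen {X : Type*} [TopologicalSpace X] : IsSetRing {s : Set X | IsClopen s} :=
  ⟨isClopen_empty, fun _ _ hs ht => hs.union ht, fun _ _ hs ht => hs.diff ht⟩

theorem isSigmaSubadditive_of_compactSpace {X : Type*} [TopologicalSpace X] [CompactSpace X]
    (m : AddContent ℝ≥0∞ {s : Set X | IsClopen s}) : m.IsSigmaSubadditive := by
  intro f hf hU
  obtain ⟨T, hT⟩ := hU.1.isCompact.elim_finite_subcover f (fun i => (hf i).2) subset_rfl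
  have hT' : ⋃ i, f i = ⋃ i ∈ T, f i := hT.antisymm (Set.iUnion₂_subset_iUnion _ _)
  calc m (⋃ i, f i) = m (⋃ i ∈ T, f i) := by rw [hT']
    _ ≤ ∑ i ∈ T, m (f i) :=
        addContent_biUnion_le isSetRing_isClopen fun i _ => hf i
    _ ≤ ∑' i, m (f i) := ENNReal.sum_le_tsum T

/-- On the clopen sets where `m a` does not converge the values are chosen along an ultrafilter,
so that they are still additive. -/
theorem exists_measure_of_tendsto_isClopen {X α : Type*} [TopologicalSpace X] [CompactSpace X]
    [MeasurableSpace X] [BorelSpace X]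
    (hgen : borel X = MeasurableSpace.generateFrom {s : Set X | IsClopen s})
    {l : Filter α} [l.NeBot] {m : α → Measure X} {c : ℝ≥0∞} (hc : c ≠ ∞)
    (h : Tendsto (fun a => m a Set.univ) l (𝓝 c)) :
    ∃ μ : Measure X, IsFiniteMeasure μ ∧
      ∀ s, IsClopen s → ∀ t, Tendsto (fun a => m a s) l (𝓝 t) → μ s = t := by
  let U := Ultrafilter.of l
  let F : Set X → ℝ≥0∞ := fun s => (U.map fun a => m a s).lim
  have hF s : Tendsto (fun a => m a s) U (𝓝 (F s)) := (U.map fun a => m a s).le_nhds_lim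
  have hval : ∀ s t, Tendsto (fun a => m a s) l (𝓝 t) → F s = t := fun s t ht =>
    tendsto_nhds_unique (hF s) (ht.mono_left (Ultrafilter.of_le l))
  have hadd : ∀ {s t : Set X}, IsClopen s → IsClopen t → Disjoint s t →
      F (s ∪ t) = F s + F t := fun {s t} _ ht hd =>
    tendsto_nhds_unique (hF _)
      (((hF s).add (hF t)).congr fun a => (measure_union hd ht.1.measurableSet).symm)
  let A : AddContent ℝ≥0∞ {s : Set X | IsClopen s} :=
    isSetRing_isClopen.addContent_of_union F (hval _ _ (by simp)) hadd
  have hgen' := (BorelSpace.measurable_eq (α := X)).trans hgen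
  let μ := A.measure isSetRing_isClopen.isSetSemiring hgen'.le
    (isSigmaSubadditive_of_compactSpace A)
  have hμ s (hs : IsClopen s) t (ht : Tendsto (fun a => m a s) l (𝓝 t)) : μ s = t :=
    (AddContent.measure_eq A isSetRing_isClopen.isSetSemiring hgen'
      (isSigmaSubadditive_of_compactSpace A) hs).trans (hval s t ht)
  exact ⟨μ, ⟨(hμ _ isClopen_univ c h).trans_lt hc.lt_top⟩, hμ⟩

/-! ## Abel means -/

section AbelMean

variable {E : Type*} [NormedAddCommGroup E] [NormedSpace ℝ E]

/-- The Abel mean `(1 - r) ∑ r ^ q • a q` of a sequence; it is used for `r` increasing to `1`. -/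
def abelMean (a : ℕ → E) (r : ℝ) : E := (1 - r) • ∑' q, r ^ q • a q

theorem norm_geometric_smul_le {a : ℕ → E} {C : ℝ} (ha : ∀ q, ‖a q‖ ≤ C) {r : ℝ} (h0 : 0 ≤ r)
    (q : ℕ) : ‖r ^ q • a q‖ ≤ r ^ q * C := by
  rw [norm_smul, norm_pow, Real.norm_of_nonneg h0]
  exact mul_le_mul_of_nonneg_left (ha q) (pow_nonneg h0 q)

theorem norm_abelMean_le {a : ℕ → E} {C : ℝ} (ha : ∀ q, ‖a q‖ ≤ C) {r : ℝ} (h0 : 0 ≤ r)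
    (h1 : r < 1) : ‖abelMean a r‖ ≤ C := by
  have hr : 0 < 1 - r := sub_pos.mpr h1
  have hsum : HasSum (fun q => r ^ q * C) ((1 - r)⁻¹ * C) :=
    (hasSum_geometric_of_lt_one h0 h1).mul_right C
  calc ‖abelMean a r‖ = (1 - r) * ‖∑' q, r ^ q • a q‖ := by
        rw [abelMean, norm_smul, Real.norm_of_nonneg hr.le]
    _ ≤ (1 - r) * ((1 - r)⁻¹ * C) :=
        mul_le_mul_of_nonneg_left
          (tsum_of_norm_bounded hsum (norm_geometric_smul_le ha h0)) hr.le
    _ = C := mul_inv_cancel_left₀ hr.ne' C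

variable [CompleteSpace E]

theorem summable_geometric_smul {a : ℕ → E} {C : ℝ} (ha : ∀ q, ‖a q‖ ≤ C) {r : ℝ} (h0 : 0 ≤ r)
    (h1 : r < 1) : Summable fun q => r ^ q • a q :=
  .of_norm_bounded ((summable_geometric_of_lt_one h0 h1).mul_right C)
    (norm_geometric_smul_le ha h0)

theorem abelMean_const_add (g : E) {a : ℕ → E} {C : ℝ} (ha : ∀ q, ‖a q‖ ≤ C) {r : ℝ}
    (h0 : 0 ≤ r) (h1 : r < 1) : abelMean (fun q => g + a q) r = g + abelMean a r := by
  have hg := summable_geometric_smul (a := fun _ => g) (fun _ => le_rfl) h0 h1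
  simp only [abelMean, smul_add]
  rw [hg.tsum_add (summable_geometric_smul ha h0 h1), smul_add,
    (summable_geometric_of_lt_one h0 h1).tsum_smul_const, tsum_geometric_of_lt_one h0 h1,
    smul_inv_smul₀ (sub_pos.mpr h1).ne']

theorem abelMean_sub_shift {a : ℕ → E} {C : ℝ} (ha : ∀ q, ‖a q‖ ≤ C) {r : ℝ} (h0 : 0 < r)
    (h1 : r < 1) :
    abelMean (fun q => a q - a (q + 1)) r = ((1 - r) / r) • (a 0 - abelMean a r) := by
  have hsum := summable_geometric_smul ha h0.le h1
  have hshift := summable_geometric_smul (a := fun q => a (q + 1)) (fun q => ha (q + 1)) h0.le h1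
  have hrec : ∑' q, r ^ q • a q = a 0 + r • ∑' q, r ^ q • a (q + 1) := by
    rw [hsum.tsum_eq_zero_add, ← hshift.tsum_const_smul]
    simp only [pow_zero, one_smul, pow_succ', mul_smul]
  simp only [abelMean, smul_sub (_ ^ _)]
  rw [hsum.tsum_sub hshift, hrec]
  match_scalars <;> field_simp <;> ring

theorem tendsto_abelMean_sub_shift {a : ℕ → E} {C : ℝ} (ha : ∀ q, ‖a q‖ ≤ C) :
    Tendsto (abelMean fun q => a q - a (q + 1)) (𝓝[<] 1) (𝓝 0) := by
  have hcoef : Tendsto (fun r : ℝ => (1 - r) / r) (𝓝[<] 1) (𝓝 0) := by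
    have h : ContinuousAt (fun r : ℝ => (1 - r) / r) 1 :=
      (continuousAt_const.sub continuousAt_id).div continuousAt_id one_ne_zero
    simpa using h.tendsto.mono_left (nhdsWithin_le_nhds (s := Set.Iio 1))
  refine squeeze_zero_norm' (a := fun r => |(1 - r) / r| * (C + C)) ?_
    (by simpa using hcoef.abs.mul_const (C + C))
  filter_upwards [Ioo_mem_nhdsLT (zero_lt_one' ℝ)] with r ⟨h0, h1⟩
  rw [abelMean_sub_shift ha h0 h1, norm_smul, Real.norm_eq_abs]
  exact mul_le_mul_of_nonneg_left
    ((norm_sub_le _ _).trans (add_le_add (ha 0) (norm_abelMean_le ha h0.le h1))) (abs_nonneg _)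

end AbelMean

section PowerBounded

variable {E : Type*} [NormedAddCommGroup E] [NormedSpace ℝ E] {T : E →ₗ[ℝ] E}

theorem disjoint_ker_range_of_bounded_pow (hT : ∀ f, ∃ C, ∀ q : ℕ, ‖(T ^ q) f‖ ≤ C) :
    Disjoint (LinearMap.ker (1 - T)) (LinearMap.range (1 - T)) := by
  rw [Submodule.disjoint_def]
  rintro f hf ⟨g, rfl⟩
  set f := (1 - T) g with hfg
  have hTf : T f = f := (sub_eq_zero.mp (hf : f - T f = 0)).symm
  have hTg : T g = g - f := by simp [hfg]
  have horbit : ∀ q : ℕ, (T ^ q) g = g - (q : ℝ) • f := by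
    intro q
    induction q with
    | zero => simp
    | succ q ih =>
      rw [pow_succ', Module.End.mul_apply, ih, map_sub, map_smul, hTf, hTg]
      push_cast
      module
  obtain ⟨C, hC⟩ := hT g
  have hbound : ∀ q : ℕ, q * ‖f‖ ≤ ‖g‖ + C := fun q =>
    calc q * ‖f‖ = ‖g - (T ^ q) g‖ := by
          rw [horbit, sub_sub_cancel, norm_smul, Real.norm_natCast]
      _ ≤ ‖g‖ + C := (norm_sub_le _ _).trans (add_le_add_right (hC q) _)
  by_contra hne
  obtain ⟨q, hq⟩ := exists_nat_gt ((‖g‖ + C) / ‖f‖)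
  exact (hbound q).not_gt ((div_lt_iff₀ (norm_pos_iff.mpr hne)).mp hq)

theorem exists_tendsto_abelMean_orbit [FiniteDimensional ℝ E]
    (hT : ∀ f, ∃ C, ∀ q : ℕ, ‖(T ^ q) f‖ ≤ C) (f : E) :
    ∃ L, Tendsto (abelMean fun q => (T ^ q) f) (𝓝[<] 1) (𝓝 L) := by
  have : CompleteSpace E := FiniteDimensional.complete ℝ E
  have htop : LinearMap.ker (1 - T) ⊔ LinearMap.range (1 - T) = ⊤ :=
    Submodule.eq_top_of_disjoint _ _
      (by rw [add_comm, LinearMap.finrank_range_add_finrank_ker])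
      (disjoint_ker_range_of_bounded_pow hT)
  obtain ⟨g, hg, _, ⟨h, rfl⟩, rfl⟩ := Submodule.mem_sup.mp (htop ▸ Submodule.mem_top (x := f))
  have hTg : Function.IsFixedPt T g := (sub_eq_zero.mp (hg : g - T g = 0)).symm
  have horbit q : (T ^ q) (g + (1 - T) h) = g + ((T ^ q) h - (T ^ (q + 1)) h) := by
    rw [map_add, Module.End.pow_apply T q g, (hTg.iterate q).eq, LinearMap.sub_apply, map_sub,
      pow_succ, Module.End.mul_apply, Module.End.one_apply]
  obtain ⟨C, hC⟩ := hT h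
  have hdiff q : ‖(T ^ q) h - (T ^ (q + 1)) h‖ ≤ C + C :=
    (norm_sub_le _ _).trans (add_le_add (hC q) (hC (q + 1)))
  refine ⟨g + 0, (tendsto_const_nhds.add (tendsto_abelMean_sub_shift hC)).congr' ?_⟩
  filter_upwards [Ioo_mem_nhdsLT (zero_lt_one' ℝ)] with r ⟨h0, h1⟩
  simp only [horbit]
  exact (abelMean_const_add g hdiff h0.le h1).symm

theorem exists_tendsto_abelMean_mulVec {ι : Type*} [Fintype ι] [DecidableEq ι]
    {M : Matrix ι ι ℝ} (hM : ∀ f, ∃ C, ∀ q : ℕ, ‖(M ^ q).mulVec f‖ ≤ C) (f : ι → ℝ) (i : ι) :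
    ∃ L, Tendsto (abelMean fun q => (M ^ q).mulVec f i) (𝓝[<] 1) (𝓝 L) := by
  have hpow (g : ι → ℝ) (q : ℕ) : (M.toLin' ^ q) g = (M ^ q).mulVec g := by
    rw [← Matrix.toLin'_pow, Matrix.toLin'_apply]
  obtain ⟨L, hL⟩ := exists_tendsto_abelMean_orbit (T := M.toLin') (by simpa only [hpow]) f
  obtain ⟨C, hC⟩ := hM f
  refine ⟨L i, ((continuous_apply i).continuousAt.tendsto.comp hL).congr' ?_⟩
  filter_upwards [Ioo_mem_nhdsLT (zero_lt_one' ℝ)] with r ⟨h0, h1⟩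
  simp only [hpow, Function.comp_apply, abelMean, Pi.smul_apply]
  rw [tsum_apply (summable_geometric_smul hC h0.le h1)]
  rfl

end PowerBounded

theorem tendsto_rpow_one_sub {ρ : ℝ} (hρ : 1 < ρ) :
    Tendsto (fun s : ℝ => ρ ^ (1 - s)) (𝓝[>] 1) (𝓝[<] 1) := by
  refine tendsto_nhdsWithin_iff.mpr ⟨?_, ?_⟩
  · have hcont : Continuous fun s : ℝ => ρ ^ (1 - s) :=
      (Real.continuous_const_rpow (zero_lt_one.trans hρ).ne').comp (continuous_sub_left 1)
    simpa using (hcont.tendsto 1).mono_left (nhdsWithin_le_nhds (s := Set.Ioi 1))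
  · filter_upwards [self_mem_nhdsWithin] with s hs
      using Real.rpow_lt_one_of_one_lt_of_neg hρ (sub_neg.mpr hs)

theorem tendsto_sub_one_div_one_sub_rpow {ρ : ℝ} (hρ : 1 < ρ) :
    Tendsto (fun s : ℝ => (s - 1) / (1 - ρ ^ (1 - s))) (𝓝[>] 1) (𝓝 (Real.log ρ)⁻¹) := by
  have hderiv : HasDerivAt (fun s : ℝ => 1 - ρ ^ (1 - s)) (Real.log ρ) 1 := by
    simpa using (((hasDerivAt_id (1 : ℝ)).const_sub 1).const_rpow
      (zero_lt_one.trans hρ)).const_sub 1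
  have hslope := (hasDerivAt_iff_tendsto_slope.mp hderiv).mono_left
    (nhdsWithin_mono (1 : ℝ) fun s (hs : 1 < s) => hs.ne')
  refine (hslope.inv₀ (Real.log_pos hρ).ne').congr fun s => ?_
  simp [slope_def_field]

theorem tendsto_sub_one_mul_tsum {a : ℕ → ℝ} {L : ℝ} (ha : Tendsto (abelMean a) (𝓝[<] 1) (𝓝 L))
    {ρ : ℝ} (hρ : 1 < ρ) :
    Tendsto (fun s : ℝ => (s - 1) * ∑' q, (ρ ^ (1 - s)) ^ q * a q) (𝓝[>] 1)
      (𝓝 ((Real.log ρ)⁻¹ * L)) := by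
  have hr := tendsto_rpow_one_sub hρ
  refine ((tendsto_sub_one_div_one_sub_rpow hρ).mul (ha.comp hr)).congr' ?_
  filter_upwards [hr.eventually self_mem_nhdsWithin] with s hs
  simp only [Function.comp_apply, abelMean, smul_eq_mul]
  rw [← mul_assoc, div_mul_cancel₀ _ (sub_pos.mpr hs).ne']

/-! ## Positive matrices -/

section PositiveEigenvector

variable {ι : Type*} [Fintype ι] {M : Matrix ι ι ℝ} {x : ι → ℝ} {t : ℝ}

theorem norm_sum_smul_le_of_mulVec_eq {E : Type*} [NormedAddCommGroup E] [NormedSpace ℝ E]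
    (hM : ∀ i j, 0 ≤ M i j) (hx : M.mulVec x = t • x) {f : ι → E} {c : ℝ}
    (hf : ∀ j, ‖f j‖ ≤ c * x j) (i : ι) : ‖∑ j, M i j • f j‖ ≤ t * (c * x i) :=
  calc ‖∑ j, M i j • f j‖ ≤ ∑ j, ‖M i j • f j‖ := norm_sum_le _ _
    _ ≤ ∑ j, c * (M i j * x j) := Finset.sum_le_sum fun j _ => by
        rw [norm_smul, Real.norm_of_nonneg (hM i j), mul_left_comm]
        exact mul_le_mul_of_nonneg_left (hf j) (hM i j)
    _ = c * M.mulVec x i := (Finset.mul_sum _ _ _).symm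
    _ = t * (c * x i) := by rw [hx, Pi.smul_apply, smul_eq_mul, mul_left_comm]

theorem exists_norm_le_mul {ι : Type*} [Finite ι] [Nonempty ι] {x : ι → ℝ} {E : Type*}
    [NormedAddCommGroup E] (hx0 : ∀ i, 0 < x i) (f : ι → E) :
    ∃ i, ∀ j, ‖f j‖ ≤ ‖f i‖ / x i * x j := by
  obtain ⟨i, hi⟩ := Finite.exists_max fun i => ‖f i‖ / x i
  exact ⟨i, fun j => (div_le_iff₀ (hx0 j)).mp (hi j)⟩

theorem exists_norm_pow_mulVec_le [DecidableEq ι] (hM : ∀ i j, 0 ≤ M i j)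
    (hx0 : ∀ i, 0 < x i) (hx : M.mulVec x = x) (f : ι → ℝ) :
    ∃ C, ∀ q : ℕ, ‖(M ^ q).mulVec f‖ ≤ C := by
  cases isEmpty_or_nonempty ι
  · exact ⟨0, fun q => by simp [Subsingleton.elim ((M ^ q).mulVec f) 0]⟩
  obtain ⟨i₀, h₀⟩ := exists_norm_le_mul hx0 f
  have horbit : ∀ (q : ℕ) j, ‖(M ^ q).mulVec f j‖ ≤ ‖f i₀‖ / x i₀ * x j := by
    intro q
    induction q with
    | zero => simpa using h₀
    | succ q ih =>
      intro j
      rw [pow_succ', ← Matrix.mulVec_mulVec, ← one_mul (_ * x j)]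
      exact norm_sum_smul_le_of_mulVec_eq hM (hx.trans (one_smul ℝ x).symm) ih j
  refine ⟨‖f i₀‖ / x i₀ * ‖x‖, fun q => (pi_norm_le_iff_of_nonempty _).mpr fun j => ?_⟩
  exact (horbit q j).trans (mul_le_mul_of_nonneg_left
    ((le_abs_self _).trans (norm_le_pi_norm x j)) (div_nonneg (norm_nonneg _) (hx0 i₀).le))

theorem nonneg_of_mulVec_eq [Nonempty ι] (hM : ∀ i j, 0 ≤ M i j) (hx0 : ∀ i, 0 < x i)
    (hx : M.mulVec x = t • x) : 0 ≤ t := by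
  obtain ⟨i⟩ := ‹Nonempty ι›
  refine nonneg_of_mul_nonneg_left (b := x i) ?_ (hx0 i)
  rw [← smul_eq_mul, ← Pi.smul_apply, ← hx]
  exact Finset.sum_nonneg fun j _ => mul_nonneg (hM i j) (hx0 j).le

theorem spectralRadius_eq_of_mulVec_eq [DecidableEq ι] [Nonempty ι] (hM : ∀ i j, 0 ≤ M i j)
    (hx0 : ∀ i, 0 < x i) (hx : M.mulVec x = t • x) :
    spectralRadius ℂ (M.map ((↑) : ℝ → ℂ)) = ENNReal.ofReal t := by
  have ht : 0 ≤ t := nonneg_of_mulVec_eq hM hx0 hx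
  have hnorm (z : ℂ) : (‖z‖₊ : ℝ≥0∞) = ENNReal.ofReal ‖z‖ := by
    rw [ENNReal.ofReal, norm_toNNReal]
  simp only [spectralRadius, hnorm, ← Matrix.spectrum_toLin',
    ← Module.End.hasEigenvalue_iff_mem_spectrum]
  refine le_antisymm (iSup₂_le fun z hz => ENNReal.ofReal_le_ofReal ?_) ?_
  · obtain ⟨f, hf, hf0⟩ := hz.exists_hasEigenvector
    rw [Module.End.mem_eigenspace_iff, Matrix.toLin'_apply] at hf
    obtain ⟨i, hi⟩ := exists_norm_le_mul hx0 f
    have hfi : 0 < ‖f i‖ := by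
      refine norm_pos_iff.mpr fun h => hf0 (funext fun j => norm_le_zero_iff.mp ?_)
      simpa [h] using hi j
    have hz : ∑ j, M i j • f j = z * f i := by
      simpa [Matrix.mulVec, dotProduct] using congrFun hf i
    have hle := norm_sum_smul_le_of_mulVec_eq hM hx hi i
    rw [hz, norm_mul, div_mul_cancel₀ _ (hx0 i).ne'] at hle
    exact le_of_mul_le_mul_right hle hfi
  · have heig : Module.End.HasEigenvalue (Matrix.toLin' (M.map ((↑) : ℝ → ℂ))) (t : ℂ) := by
      refine Module.End.hasEigenvalue_of_hasEigenvector (x := fun i => (x i : ℂ)) ⟨?_, ?_⟩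
      · rw [Module.End.mem_eigenspace_iff, Matrix.toLin'_apply]
        funext i
        simpa [Matrix.mulVec, dotProduct] using congrArg ((↑) : ℝ → ℂ) (congrFun hx i)
      · exact fun h => (hx0 (Classical.arbitrary ι)).ne'
          (Complex.ofReal_eq_zero.mp (congrFun h (Classical.arbitrary ι)))
    refine le_iSup₂_of_le (t : ℂ) heig ?_
    rw [Complex.norm_of_nonneg ht]

end PositiveEigenvector

section Perron

variable {ι : Type*} [Fintype ι] {M : Matrix ι ι ℝ}

theorem mulVec_pos_of_pos (hM : ∀ i j, 0 < M i j) {y : ι → ℝ} (hy : 0 ≤ y) (hne : y ≠ 0)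
    (i : ι) : 0 < M.mulVec y i := by
  obtain ⟨j, hj⟩ := Function.ne_iff.mp hne
  exact Finset.sum_pos' (fun l _ => mul_nonneg (hM i l).le (hy l))
    ⟨j, Finset.mem_univ j, mul_pos (hM i j) ((hy j).lt_of_ne' hj)⟩

theorem exists_mul_le {ι : Type*} [Finite ι] [Nonempty ι] {x : ι → ℝ} (hx0 : ∀ i, 0 < x i)
    (y : ι → ℝ) : ∃ i, ∀ j, y i / x i * x j ≤ y j := by
  obtain ⟨i, hi⟩ := Finite.exists_min fun i => y i / x i
  exact ⟨i, fun j => (le_div_iff₀ (hx0 j)).mp (hi j)⟩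

/-- The set maximised over in the Collatz–Wielandt variational formula: the pairs `(t, x)` with
`x` in the standard simplex and `t x ≤ M x`. -/
def collatzWielandtSet (M : Matrix ι ι ℝ) : Set (ℝ × (ι → ℝ)) :=
  {p | 0 ≤ p.1 ∧ p.2 ∈ stdSimplex ℝ ι ∧ p.1 • p.2 ≤ M.mulVec p.2}

theorem isCompact_collatzWielandtSet (hM : ∀ i j, 0 ≤ M i j) :
    IsCompact (collatzWielandtSet M) := by
  have hle : IsClosed {p : ℝ × (ι → ℝ) | p.1 • p.2 ≤ M.mulVec p.2} :=
    isClosed_le (continuous_fst.smul continuous_snd)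
      (continuous_const.matrix_mulVec continuous_snd)
  have hclosed : IsClosed (collatzWielandtSet M) :=
    (isClosed_le continuous_const continuous_fst).inter
      (((isClosed_stdSimplex ℝ ι).preimage continuous_snd).inter hle)
  refine ((isCompact_Icc (a := 0) (b := ∑ i, ∑ j, M i j)).prod
    (isCompact_stdSimplex ℝ ι)).of_isClosed_subset hclosed ?_
  rintro ⟨t, x⟩ ⟨ht, hx, hle⟩
  refine ⟨⟨ht, ?_⟩, hx⟩
  calc t = ∑ i, (t • x) i := by simp only [Pi.smul_apply, ← Finset.smul_sum, hx.2]; simp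
    _ ≤ ∑ i, ∑ j, M i j * x j := Finset.sum_le_sum fun i _ => hle i
    _ ≤ ∑ i, ∑ j, M i j := Finset.sum_le_sum fun i _ => Finset.sum_le_sum fun j _ =>
        mul_le_of_le_one_right (hM i j) (hx.2 ▸ Finset.single_le_sum (fun l _ => hx.1 l)
          (Finset.mem_univ j))

theorem nonempty_collatzWielandtSet [Nonempty ι] (hM : ∀ i j, 0 ≤ M i j) :
    (collatzWielandtSet M).Nonempty := by
  classical
  have hx := single_mem_stdSimplex ℝ (Classical.arbitrary ι)
  refine ⟨(0, _), le_rfl, hx, fun i => ?_⟩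
  rw [zero_smul]
  exact Finset.sum_nonneg fun j _ => mul_nonneg (hM i j) (hx.1 j)

theorem ne_zero_of_mem_stdSimplex {x : ι → ℝ} (hx : x ∈ stdSimplex ℝ ι) : x ≠ 0 := by
  rintro rfl
  simpa using hx.2

/-- If `M x ≠ t x`, applying `M` once more makes all the inequalities `t x ≤ M x` strict. -/
theorem mulVec_eq_of_maximal [Nonempty ι] (hM : ∀ i j, 0 < M i j) {t : ℝ} {x : ι → ℝ}
    (h : (t, x) ∈ collatzWielandtSet M) (hmax : ∀ p ∈ collatzWielandtSet M, p.1 ≤ t) :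
    M.mulVec x = t • x := by
  obtain ⟨ht, hx, hle⟩ := h
  by_contra hne
  have hMx := mulVec_pos_of_pos hM hx.1 (ne_zero_of_mem_stdSimplex hx)
  have hMy := mulVec_pos_of_pos hM (sub_nonneg.mpr hle) (sub_ne_zero.mpr hne)
  obtain ⟨i, hi⟩ := exists_mul_le hMx (M.mulVec (M.mulVec x - t • x))
  set ε := M.mulVec (M.mulVec x - t • x) i / M.mulVec x i
  have hε : 0 < ε := div_pos (hMy i) (hMx i)
  set S := ∑ j, M.mulVec x j
  have hS : 0 < S := Finset.sum_pos (fun j _ => hMx j) Finset.univ_nonempty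
  refine (lt_add_of_pos_right t hε).not_ge
    (hmax (t + ε, S⁻¹ • M.mulVec x) ⟨by positivity, ⟨fun j => ?_, ?_⟩, fun j => ?_⟩)
  · exact mul_nonneg (inv_nonneg.mpr hS.le) (hMx j).le
  · simp only [Pi.smul_apply, ← Finset.smul_sum]
    exact inv_mul_cancel₀ hS.ne'
  · have hj := hi j
    simp only [Matrix.mulVec_sub, Matrix.mulVec_smul, Pi.sub_apply, Pi.smul_apply,
      smul_eq_mul] at hj ⊢
    calc (t + ε) * (S⁻¹ * M.mulVec x j) = S⁻¹ * ((t + ε) * M.mulVec x j) := by ring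
      _ ≤ S⁻¹ * M.mulVec (M.mulVec x) j := by gcongr; linarith

theorem exists_pos_mulVec_eq [Nonempty ι] (hM : ∀ i j, 0 < M i j) :
    ∃ (x : ι → ℝ) (t : ℝ), (∀ i, 0 < x i) ∧ ∑ i, x i = 1 ∧ M.mulVec x = t • x := by
  have hM' : ∀ i j, 0 ≤ M i j := fun i j => (hM i j).le
  obtain ⟨⟨t, x⟩, hmem, hmax⟩ := (isCompact_collatzWielandtSet hM').exists_isMaxOn
    (nonempty_collatzWielandtSet hM') continuous_fst.continuousOn
  have heq := mulVec_eq_of_maximal hM hmem hmax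
  refine ⟨x, t, fun i => ?_, hmem.2.1.2, heq⟩
  have hi := mulVec_pos_of_pos hM hmem.2.1.1 (ne_zero_of_mem_stdSimplex hmem.2.1) i
  rw [heq] at hi
  exact pos_of_mul_pos_right hi hmem.1

theorem exists_eq_smul_of_mulVec_eq [Nonempty ι] (hM : ∀ i j, 0 < M i j) {x y : ι → ℝ} {t : ℝ}
    (hx0 : ∀ i, 0 < x i) (hx : M.mulVec x = t • x) (hy : M.mulVec y = t • y) :
    ∃ c : ℝ, y = c • x := by
  obtain ⟨i, hi⟩ := exists_mul_le hx0 y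
  refine ⟨y i / x i, sub_eq_zero.mp ?_⟩
  set z := y - (y i / x i) • x with hz
  have hMz : M.mulVec z = t • z := by
    rw [hz, Matrix.mulVec_sub, Matrix.mulVec_smul, hx, hy, smul_sub, smul_comm]
  have hzi : z i = 0 := by simp [hz, div_mul_cancel₀ _ (hx0 i).ne']
  by_contra hne
  have hpos := mulVec_pos_of_pos hM (y := z) (fun j => sub_nonneg.mpr (hi j)) hne i
  simp [hMz, hzi] at hpos

theorem exists_pos_of_forall_exists_pow_pos [DecidableEq ι] {S : Matrix ι ι ℝ}
    (hS : ∀ i j, 0 ≤ S i j) (hpow : ∀ i j, ∃ n : ℕ, 0 < (S ^ n) i j) :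
    ∃ M : Matrix ι ι ℝ, (∀ i j, 0 < M i j) ∧ ∀ N, Commute S N → Commute M N := by
  have hnonneg : ∀ (n : ℕ) i j, 0 ≤ (S ^ n) i j := Matrix.pow_apply_nonneg hS
  choose n hn using hpow
  refine ⟨∑ i, ∑ j, S ^ n i j, fun i j => ?_, fun N hN => ?_⟩
  · simp only [Matrix.sum_apply]
    exact Finset.sum_pos' (fun _ _ => Finset.sum_nonneg fun _ _ => hnonneg _ i j)
      ⟨i, Finset.mem_univ i, Finset.sum_pos' (fun _ _ => hnonneg _ i j)
        ⟨j, Finset.mem_univ j, hn i j⟩⟩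
  · exact .sum_left _ _ _ fun i _ => .sum_left _ _ _ fun j _ => hN.pow_left _

theorem exists_pos_common_eigenvector [DecidableEq ι] [Nonempty ι] {S : Matrix ι ι ℝ}
    (hS : ∀ i j, 0 ≤ S i j) (hpow : ∀ i j, ∃ n : ℕ, 0 < (S ^ n) i j) :
    ∃ x : ι → ℝ, (∀ i, 0 < x i) ∧ ∑ i, x i = 1 ∧
      ∀ N, Commute S N → ∃ t : ℝ, N.mulVec x = t • x := by
  obtain ⟨M, hM, hcomm⟩ := exists_pos_of_forall_exists_pow_pos hS hpow
  obtain ⟨x, t, hx0, hsum, hx⟩ := exists_pos_mulVec_eq hM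
  refine ⟨x, hx0, hsum, fun N hN => exists_eq_smul_of_mulVec_eq hM hx0 hx ?_⟩
  rw [Matrix.mulVec_mulVec, (hcomm N hN).eq, ← Matrix.mulVec_mulVec, hx, Matrix.mulVec_smul]

end Perron

/-! ## The Perron–Frobenius eigenvector of a higher-rank graph -/

namespace HigherRankGraph

variable {k : ℕ} {V : Type u} [Category.{v} V] {Λ : HigherRankGraph k V}

theorem IsFinite.finite_hom (hfin : Λ.IsFinite) (n : Fin k → ℕ) (x y : V) :
    Finite {f : x ⟶ y // Λ.deg f = n} := by
  have := hfin n
  refine Finite.of_injective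
    (fun f => (⟨⟨x, y, f.1⟩, f.2⟩ : {f : Σ x : V, Σ y : V, (x ⟶ y) // Λ.deg f.2.2 = n})) ?_
  rintro ⟨f, hf⟩ ⟨g, hg⟩ h
  simpa using h

variable (Λ) in
/-- The matrix whose entry at `(v, w)` is the number of morphisms of degree `n` with range `v` and
source `w`. -/
def degCount (n : Fin k → ℕ) : Matrix V V ℕ :=
  Matrix.of fun v w => Nat.card {f : w ⟶ v // Λ.deg f = n}

variable (Λ) in
theorem bijective_comp_of_deg (m n : Fin k → ℕ) (v w : V) :
    Function.Bijective fun p : Σ y : V, {f : y ⟶ v // Λ.deg f = m} × {g : w ⟶ y // Λ.deg g = n} =>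
      (⟨p.2.2.1 ≫ p.2.1.1, by rw [Λ.deg_comp, p.2.1.2, p.2.2.2]⟩ :
        {f : w ⟶ v // Λ.deg f = m + n}) := by
  constructor
  · rintro ⟨y, ⟨f, hf⟩, ⟨g, hg⟩⟩ ⟨y', ⟨f', hf'⟩, ⟨g', hg'⟩⟩ h
    have hcomp : g ≫ f = g' ≫ f' := congrArg Subtype.val h
    have heq := (Λ.factorization (g ≫ f) m n (by rw [Λ.deg_comp, hf, hg])).unique
      (y₁ := ⟨y, g, f⟩) (y₂ := ⟨y', g', f'⟩) ⟨hf, hg, rfl⟩ ⟨hf', hg', hcomp.symm⟩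
    cases heq
    rfl
  · rintro ⟨f, hf⟩
    obtain ⟨⟨y, g, h⟩, hh, hg, rfl⟩ := (Λ.factorization f m n hf).exists
    exact ⟨⟨y, ⟨h, hh⟩, ⟨g, hg⟩⟩, rfl⟩

theorem eq_of_deg_eq_zero {x y : V} {f : x ⟶ y} (hf : Λ.deg f = 0) : x = y :=
  congrArg Sigma.fst ((Λ.factorization f 0 0 (by rw [hf, zero_add])).unique
    (y₁ := ⟨x, 𝟙 x, f⟩) (y₂ := ⟨y, f, 𝟙 y⟩)
    ⟨hf, Λ.deg_id x, Category.id_comp f⟩ ⟨Λ.deg_id y, hf, Category.comp_id f⟩)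

variable [Fintype V]

theorem degCount_mul (hfin : Λ.IsFinite) (m n : Fin k → ℕ) :
    Λ.degCount m * Λ.degCount n = Λ.degCount (m + n) := by
  have := hfin.finite_hom
  ext v w
  rw [Matrix.mul_apply, degCount, degCount, degCount, Matrix.of_apply,
    ← Nat.card_congr (.ofBijective _ (Λ.bijective_comp_of_deg m n v w)), Nat.card_sigma]
  simp only [Matrix.of_apply, Nat.card_prod]

theorem commute_adj (hfin : Λ.IsFinite) (i j : Fin k) : Commute (Λ.adj i) (Λ.adj j) :=
  (degCount_mul hfin _ _).trans ((congrArg _ (add_comm _ _)).trans (degCount_mul hfin _ _).symm)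

variable [DecidableEq V]

theorem pow_sum_adj_pos (hfin : Λ.IsFinite) {N : ℕ} {v w : V} (f : w ⟶ v)
    (hf : ∑ i, Λ.deg f i = N) : 0 < ((∑ i, Λ.adj i) ^ N) v w := by
  induction N generalizing v with
  | zero =>
    have hdeg : Λ.deg f = 0 := funext fun i => Finset.sum_eq_zero_iff.mp hf i (Finset.mem_univ i)
    simp [eq_of_deg_eq_zero hdeg]
  | succ N ih =>
    obtain ⟨i, -, hi⟩ := Finset.exists_ne_zero_of_sum_ne_zero (hf.trans_ne N.succ_ne_zero)
    have hsplit : Λ.deg f = Pi.single i 1 + (Λ.deg f - Pi.single i 1) := by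
      refine (add_tsub_cancel_of_le fun j => ?_).symm
      rcases eq_or_ne j i with rfl | hj
      · simpa using Nat.one_le_iff_ne_zero.mpr hi
      · simp [hj]
    obtain ⟨⟨y, g, h⟩, hh, hg, -⟩ := (Λ.factorization f _ _ hsplit).exists
    have hgN : ∑ j, Λ.deg g j = N := by
      rw [hsplit] at hf
      simp only [Pi.add_apply, Finset.sum_add_distrib, ← hg, Finset.sum_pi_single',
        Finset.mem_univ, if_true] at hf
      omega
    have hadj : 0 < Λ.adj i v y := by
      have := hfin.finite_hom (Pi.single i 1) y v
      have : Nonempty {f : y ⟶ v // Λ.deg f = Pi.single i 1} := ⟨h, hh⟩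
      exact Nat.card_pos
    have hsum : 0 < (∑ i, Λ.adj i) v y := by
      rw [Matrix.sum_apply]
      exact Finset.sum_pos' (fun _ _ => Nat.zero_le _) ⟨i, Finset.mem_univ i, hadj⟩
    rw [pow_succ', Matrix.mul_apply]
    exact Finset.sum_pos' (fun _ _ => Nat.zero_le _)
      ⟨y, Finset.mem_univ y, Nat.mul_pos hsum (ih g hgN)⟩

theorem exists_isPerronFrobenius [Nonempty V] (hfin : Λ.IsFinite) (hconn : Λ.StronglyConnected) :
    ∃ x, Λ.IsPerronFrobenius x := by
  let φ : Matrix V V ℕ →+* Matrix V V ℝ := (Nat.castRingHom ℝ).mapMatrix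
  have hφ (N : Matrix V V ℕ) (v w : V) : 0 ≤ φ N v w := Nat.cast_nonneg (N v w)
  have hpow : ∀ v w, ∃ n : ℕ, 0 < (φ (∑ i, Λ.adj i) ^ n) v w := fun v w => by
    obtain ⟨f⟩ := hconn v w
    refine ⟨∑ i, Λ.deg f i, ?_⟩
    rw [← map_pow]
    exact Nat.cast_pos.mpr (pow_sum_adj_pos hfin f rfl)
  obtain ⟨x, hx0, hsum, hx⟩ := exists_pos_common_eigenvector (hφ _) hpow
  refine ⟨x, hx0, hsum, fun i => ?_⟩
  obtain ⟨t, ht⟩ :=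
    hx _ ((Commute.sum_left _ _ _ fun j _ => commute_adj hfin j i).map φ)
  have hrho : Λ.rho i = t := by
    have hmap : (Λ.adj i).map (Nat.cast : ℕ → ℂ) = (φ (Λ.adj i)).map ((↑) : ℝ → ℂ) := by
      ext
      simp [φ]
    rw [rho, hmap, spectralRadius_eq_of_mulVec_eq (hφ _) hx0 ht,
      ENNReal.toReal_ofReal (nonneg_of_mulVec_eq (hφ _) hx0 ht)]
  rw [hrho]
  exact ht

theorem isPerronFrobenius_perron [Nonempty V] (hfin : Λ.IsFinite)
    (hconn : Λ.StronglyConnected) : Λ.IsPerronFrobenius Λ.perron := by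
  have h := exists_isPerronFrobenius hfin hconn
  rw [perron, dif_pos h]
  exact h.choose_spec

theorem perron_pos (hfin : Λ.IsFinite) (hconn : Λ.StronglyConnected) (v : V) : 0 < Λ.perron v :=
  have : Nonempty V := ⟨v⟩
  (isPerronFrobenius_perron hfin hconn).1 v

theorem adj_mulVec_perron (hfin : Λ.IsFinite) (hconn : Λ.StronglyConnected) (i : Fin k) :
    ((Λ.adj i).map (Nat.cast : ℕ → ℝ)).mulVec Λ.perron = Λ.rho i • Λ.perron := by
  ext v
  have : Nonempty V := ⟨v⟩
  rw [(isPerronFrobenius_perron hfin hconn).2.2 i]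

end HigherRankGraph

/-! ## The path space of a Bratteli diagram -/

namespace BratteliDiagram

variable {B : BratteliDiagram.{u}}

theorem FinPath.ext_of_edge {n : ℕ} {γ γ' : B.FinPath n} (hroot : γ.root = γ'.root)
    (hedge : γ.edge = γ'.edge) : γ = γ' := by
  cases γ
  cases γ'
  simp_all only

instance (n : ℕ) : Finite (B.FinPath n) := by
  have := B.finite_V
  have := B.finite_E
  refine Finite.of_injective (β := B.V 0 × ∀ i : Fin n, B.E i) (fun γ => (γ.root, γ.edge)) ?_
  intro γ γ' h
  exact FinPath.ext_of_edge (congrArg Prod.fst h) (congrArg Prod.snd h)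

instance (n : ℕ) : Fintype (B.FinPath n) := Fintype.ofFinite _

/-- The initial sub-path of length `m`. -/
def FinPath.restrict {m n : ℕ} (h : m ≤ n) (γ : B.FinPath n) : B.FinPath m where
  root := γ.root
  edge i := γ.edge (Fin.castLE h i)
  root_eq hm := γ.root_eq (hm.trans_le h)
  compat i hi := γ.compat i (hi.trans_le h)

theorem FinPath.r_edge_last {n : ℕ} (γ : B.FinPath (n + 1)) :
    B.r (γ.edge (Fin.last n)) = (γ.restrict n.le_succ).source := by
  cases n with
  | zero => exact γ.root_eq Nat.one_pos
  | succ n => exact (γ.compat n (Nat.lt_succ_self _)).symm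

/-- The path obtained by adding an edge at the source. -/
def FinPath.snoc {n : ℕ} (γ : B.FinPath n) (e : B.E n) (he : B.r e = γ.source) :
    B.FinPath (n + 1) where
  root := γ.root
  edge := Fin.snoc (α := fun i : Fin (n + 1) => B.E i) γ.edge e
  root_eq h := by
    cases n with
    | zero => exact he
    | succ n =>
      have hfirst := Fin.snoc_castSucc (α := fun i : Fin (n + 1 + 1) => B.E i) e γ.edge 0
      exact (congrArg B.r hfirst).trans (γ.root_eq n.succ_pos)
  compat i h := by
    have hi := Fin.snoc_castSucc (α := fun i : Fin (n + 1) => B.E i) e γ.edge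
      ⟨i, Nat.lt_of_succ_lt_succ h⟩
    refine (congrArg B.s hi).trans ?_
    rcases (Nat.lt_succ_iff.mp h).lt_or_eq with hlt | rfl
    · have hnext := Fin.snoc_castSucc (α := fun i : Fin (n + 1) => B.E i) e γ.edge ⟨i + 1, hlt⟩
      exact (γ.compat i hlt).trans (congrArg B.r hnext).symm
    · have hlast := Fin.snoc_last (α := fun j : Fin (i + 1 + 1) => B.E j) e γ.edge
      exact (Eq.trans (congrArg B.r hlast) he).symm

theorem FinPath.restrict_snoc {n : ℕ} (γ : B.FinPath n) (e : B.E n) (he : B.r e = γ.source) :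
    (γ.snoc e he).restrict n.le_succ = γ :=
  FinPath.ext_of_edge rfl
    (funext fun i => Fin.snoc_castSucc (α := fun i : Fin (n + 1) => B.E i) e γ.edge i)

theorem FinPath.source_snoc {n : ℕ} (γ : B.FinPath n) (e : B.E n) (he : B.r e = γ.source) :
    (γ.snoc e he).source = B.s e :=
  congrArg B.s (Fin.snoc_last (α := fun i : Fin (n + 1) => B.E i) e γ.edge)

theorem FinPath.snoc_restrict {n : ℕ} (γ : B.FinPath (n + 1)) :
    (γ.restrict n.le_succ).snoc (γ.edge (Fin.last n)) γ.r_edge_last = γ := by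
  refine FinPath.ext_of_edge rfl (funext fun i => Fin.lastCases ?_ (fun j => ?_) i)
  · exact Fin.snoc_last (α := fun i : Fin (n + 1) => B.E i) _ _
  · exact Fin.snoc_castSucc (α := fun i : Fin (n + 1) => B.E i) _ _ j

variable (B) in
/-- A path of length `n + 1` is a path of length `n` followed by an edge. -/
def FinPath.succEquiv (n : ℕ) :
    B.FinPath (n + 1) ≃ Σ γ : B.FinPath n, {e : B.E n // B.r e = γ.source} where
  toFun γ := ⟨γ.restrict n.le_succ, γ.edge (Fin.last n), γ.r_edge_last⟩
  invFun p := p.1.snoc p.2.1 p.2.2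
  left_inv := FinPath.snoc_restrict
  right_inv := by
    rintro ⟨γ, e, he⟩
    refine Sigma.ext (γ.restrict_snoc e he) ((Subtype.heq_iff_coe_eq fun _ => ?_).mpr ?_)
    · exact (congrArg (fun γ' => B.r _ = FinPath.source γ') (γ.restrict_snoc e he)).to_iff
    · exact Fin.snoc_last (α := fun i : Fin (n + 1) => B.E i) e γ.edge

theorem mem_cylinder_iff_restrict_eq {m n : ℕ} (h : m ≤ n) {x : B.InfPath} {γ : B.FinPath n}
    (hx : x ∈ cylinder ⟨n, γ⟩) (η : B.FinPath m) :
    x ∈ cylinder ⟨m, η⟩ ↔ γ.restrict h = η := by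
  have hγ : x.take n = γ := hx
  rw [← hγ]
  rfl

theorem InfPath.take_eq_take {x y : B.InfPath} {n : ℕ} (h : ∀ i ≤ n, x.1 i = y.1 i) :
    x.take n = y.take n :=
  FinPath.ext_of_edge (congrArg B.r (h 0 n.zero_le)) (funext fun i => h i i.2.le)

/-- Along an ultrafilter each of the edges `x 0, x 1, …` is eventually constant. -/
instance : CompactSpace B.InfPath := by
  refine ⟨isCompact_iff_ultrafilter_le_nhds.mpr fun U _ => ?_⟩
  have := B.finite_E
  have hconst n : ∃ e : B.E n, ∀ᶠ x : B.InfPath in U, x.1 n = e := by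
    obtain ⟨e, he⟩ := Ultrafilter.eq_pure_of_finite (U.map fun x : B.InfPath => x.1 n)
    exact ⟨e, (Ultrafilter.mem_map (s := {e})).mp (he ▸ Ultrafilter.mem_pure.mpr rfl)⟩
  choose e he using hconst
  have hcompat n : B.s (e n) = B.r (e (n + 1)) := by
    obtain ⟨x, hn, hsucc⟩ := ((he n).and (he (n + 1))).exists
    rw [← hn, ← hsucc, x.2 n]
  let z : B.InfPath := ⟨e, hcompat⟩
  refine ⟨z, Set.mem_univ _, ?_⟩
  rw [TopologicalSpace.nhds_generateFrom]
  simp only [le_iInf_iff, le_principal_iff]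
  rintro _ ⟨hz, η, rfl⟩
  filter_upwards [(Set.finite_Iic η.1).eventually_all.mpr fun i _ => he i] with x hx
  exact (InfPath.take_eq_take hx).trans hz

instance : SecondCountableTopology B.InfPath :=
  ⟨⟨Set.range cylinder, Set.countable_range _, rfl⟩⟩

theorem borel_infPath_eq_generateFrom :
    borel B.InfPath = MeasurableSpace.generateFrom (Set.range (cylinder (B := B))) :=
  borel_eq_generateFrom_of_subbasis rfl

theorem borel_infPath_eq_generateFrom_isClopen :
    borel B.InfPath = MeasurableSpace.generateFrom {s | IsClopen s} := by
  refine le_antisymm ?_ (MeasurableSpace.generateFrom_le fun s hs => hs.2.measurableSet)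
  rw [borel_infPath_eq_generateFrom]
  exact MeasurableSpace.generateFrom_mono (Set.range_subset_iff.mpr isClopen_cylinder)

theorem measurableSet_cylinder (η : B.Paths) : MeasurableSet (cylinder η) :=
  (isClopen_cylinder η).1.measurableSet

theorem isPiSystem_range_cylinder : IsPiSystem (Set.range (cylinder (B := B))) := by
  have hinter {m n : ℕ} (h : m ≤ n) {η : B.FinPath m} {ξ : B.FinPath n}
      (hne : (cylinder ⟨m, η⟩ ∩ cylinder ⟨n, ξ⟩).Nonempty) :
      cylinder ⟨m, η⟩ ∩ cylinder ⟨n, ξ⟩ = cylinder ⟨n, ξ⟩ := by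
    obtain ⟨x, hxη, hxξ⟩ := hne
    have hξη := (mem_cylinder_iff_restrict_eq h hxξ η).mp hxη
    exact Set.inter_eq_right.mpr fun y hy => (mem_cylinder_iff_restrict_eq h hy η).mpr hξη
  rintro _ ⟨⟨m, η⟩, rfl⟩ _ ⟨⟨n, ξ⟩, rfl⟩ hne
  rcases le_total m n with h | h
  · exact ⟨_, (hinter h hne).symm⟩
  · rw [Set.inter_comm] at hne ⊢
    exact ⟨_, (hinter h hne).symm⟩

theorem measure_univ_eq_sum_cylinder (μ : Measure B.InfPath) (n : ℕ) :
    μ Set.univ = ∑ γ : B.FinPath n, μ (cylinder ⟨n, γ⟩) := by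
  have hunion : (Set.univ : Set B.InfPath) = ⋃ γ : B.FinPath n, cylinder ⟨n, γ⟩ :=
    (Set.iUnion_eq_univ_iff.mpr fun x => ⟨x.take n, rfl⟩).symm
  have hdisj : Pairwise (Function.onFun Disjoint fun γ : B.FinPath n => cylinder ⟨n, γ⟩) :=
    fun γ γ' hne => Set.disjoint_left.mpr fun x hx hx' => hne (Eq.trans (Eq.symm hx) hx')
  rw [hunion, measure_iUnion hdisj fun γ => measurableSet_cylinder _, tsum_fintype]

theorem measure_ext_cylinder {μ ν : Measure B.InfPath} [IsFiniteMeasure μ]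
    (h : ∀ η, μ (cylinder η) = ν (cylinder η)) : μ = ν := by
  refine ext_of_generate_finite _ borel_infPath_eq_generateFrom isPiSystem_range_cylinder
    (Set.forall_mem_range.mpr h) ?_
  rw [measure_univ_eq_sum_cylinder μ 0, measure_univ_eq_sum_cylinder ν 0]
  exact Finset.sum_congr rfl fun γ _ => h _

end BratteliDiagram

/-! ## Traces of diagonal operators -/

section Diagonal

variable {H : Type u} [NormedAddCommGroup H] [InnerProductSpace ℂ H]

theorem eq_of_inner_hilbertBasis_eq {κ : Type*} (b : HilbertBasis κ ℂ H) {x y : H}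
    (h : ∀ j, ⟪b j, x⟫_ℂ = ⟪b j, y⟫_ℂ) : x = y := by
  refine b.repr.injective (lp.ext (funext fun j => ?_))
  rw [b.repr_apply_apply, b.repr_apply_apply, h]

theorem clm_eq_of_apply_hilbertBasis_eq {κ : Type*} (b : HilbertBasis κ ℂ H) {S T : H →L[ℂ] H}
    (h : ∀ j, S (b j) = T (b j)) : S = T :=
  ContinuousLinearMap.ext_on (Submodule.dense_iff_topologicalClosure_eq_top.mpr b.dense_span)
    (Set.forall_mem_range.mpr h)

theorem boundedInverse_eq {D : H →ₗ.[ℂ] H} {R : H →L[ℂ] H}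
    (hright : ∀ ψ, ∃ hψ : R ψ ∈ D.domain, D ⟨R ψ, hψ⟩ = ψ)
    (hleft : ∀ φ : D.domain, R (D φ) = φ) : boundedInverse D = R := by
  have h : ∃ R : H →L[ℂ] H, (∀ ψ, ∃ hψ : R ψ ∈ D.domain, D ⟨R ψ, hψ⟩ = ψ) ∧
      ∀ φ : D.domain, R (D φ) = φ := ⟨R, hright, hleft⟩
  rw [boundedInverse, dif_pos h]
  ext ψ
  obtain ⟨hψ, hD⟩ := hright ψ
  have hRψ := h.choose_spec.2 ⟨R ψ, hψ⟩
  rwa [hD] at hRψ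

theorem mem_spectrum_of_apply_eq_smul {T : H →L[ℂ] H} {a : ℝ} {v : H} (hv0 : v ≠ 0)
    (hv : T v = (a : ℂ) • v) : a ∈ spectrum ℝ T := by
  rw [spectrum.mem_iff]
  intro hu
  obtain ⟨S, hS⟩ := hu.exists_left_inv
  have hSv := congrArg (fun R : H →L[ℂ] H => R v) hS
  exact hv0 (by simpa [Algebra.algebraMap_eq_smul_one, hv] using hSv.symm)

variable [CompleteSpace H]

theorem cfcHom_apply_eigenvector {T : H →L[ℂ] H} (hT : IsSelfAdjoint T) {v : H}
    (a : spectrum ℝ T) (hv : T v = ((a : ℝ) : ℂ) • v) (g : C(spectrum ℝ T, ℝ)) :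
    cfcHom hT g v = (g a : ℂ) • v := by
  have : CompactSpace (spectrum ℝ T) := isCompact_iff_compactSpace.mp (spectrum.isCompact T)
  induction g using ContinuousMap.induction_on_of_compact with
  | const r =>
    have hr : ContinuousMap.const (spectrum ℝ T) r = algebraMap ℝ C(spectrum ℝ T, ℝ) r := rfl
    rw [hr, AlgHomClass.commutes]
    simp [Algebra.algebraMap_eq_smul_one]
  | id => rw [cfcHom_id hT]; simpa using hv
  | star_id => rw [map_star, cfcHom_id hT, hT.star_eq]; simpa using hv
  | add f g hf hg => rw [map_add, add_apply, hf, hg, ← add_smul]; simp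
  | mul f g hf hg =>
    rw [map_mul, mul_apply_eq_comp, hg, map_smul, hf, smul_smul]
    simp [mul_comm]
  | frequently f hfr =>
    have hclosed : IsClosed {g : C(spectrum ℝ T, ℝ) | cfcHom hT g v = (g a : ℂ) • v} :=
      isClosed_eq ((ContinuousLinearMap.apply ℂ H v).continuous.comp (cfcHom_continuous hT))
        ((Complex.continuous_ofReal.comp (continuous_eval_const _)).smul continuous_const)
    exact hclosed.mem_of_frequently_of_tendsto hfr tendsto_id

theorem cfc_apply_eigenvector {T : H →L[ℂ] H} (hT : IsSelfAdjoint T) {a : ℝ} {v : H}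
    (hv : T v = (a : ℂ) • v) (f : ℝ → ℝ) (hf : ContinuousOn f (spectrum ℝ T)) :
    cfc f T v = (f a : ℂ) • v := by
  rcases eq_or_ne v 0 with rfl | hv0
  · simp
  · rw [cfc_apply f T]
    exact cfcHom_apply_eigenvector hT ⟨a, mem_spectrum_of_apply_eq_smul hv0 hv⟩ hv _

theorem rpow_apply_eigenvector {T : H →L[ℂ] H} (hT : 0 ≤ T) {a : ℝ} {v : H}
    (hv : T v = (a : ℂ) • v) {t : ℝ} (ht : 0 ≤ t) : (T ^ t) v = ((a ^ t : ℝ) : ℂ) • v := by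
  rw [CFC.rpow_eq_cfc_real hT]
  exact cfc_apply_eigenvector (IsSelfAdjoint.of_nonneg hT) hv _
    (Real.continuous_rpow_const ht).continuousOn

theorem abs_apply_eigenvector {R : H →L[ℂ] H} {a : ℝ} (ha : 0 ≤ a) {v : H}
    (hv : (star R * R) v = ((a ^ 2 : ℝ) : ℂ) • v) : CFC.abs R v = (a : ℂ) • v := by
  rw [CFC.abs, CFC.sqrt_eq_rpow, rpow_apply_eigenvector (star_mul_self_nonneg R) hv (by norm_num),
    ← Real.sqrt_eq_rpow, Real.sqrt_sq ha]

theorem absNegPow_apply_eigenvector {D : H →ₗ.[ℂ] H} {a : ℝ} (ha : 0 ≤ a) {v : H}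
    (hv : (star (boundedInverse D) * boundedInverse D) v = ((a ^ 2 : ℝ) : ℂ) • v) {t : ℝ}
    (ht : 0 ≤ t) : absNegPow D t v = ((a ^ t : ℝ) : ℂ) • v := by
  have hnonneg : 0 ≤ CFC.abs (boundedInverse D) := CFC.abs_nonneg _
  exact rpow_apply_eigenvector hnonneg (abs_apply_eigenvector ha hv) ht

theorem isSelfAdjoint_of_apply_hilbertBasis {κ : Type*} (b : HilbertBasis κ ℂ H) {T : H →L[ℂ] H}
    {a : κ → ℝ} (hT : ∀ j, T (b j) = (a j : ℂ) • b j) : IsSelfAdjoint T := by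
  classical
  refine clm_eq_of_apply_hilbertBasis_eq b fun j => eq_of_inner_hilbertBasis_eq b fun i => ?_
  rw [ContinuousLinearMap.star_eq_adjoint, ContinuousLinearMap.adjoint_inner_right, hT, hT,
    inner_smul_left, inner_smul_right, orthonormal_iff_ite.mp b.orthonormal]
  rcases eq_or_ne i j with rfl | hij
  · simp
  · simp [hij]

theorem nonneg_of_apply_hilbertBasis {κ : Type*} (b : HilbertBasis κ ℂ H) {T : H →L[ℂ] H}
    {a : κ → ℝ} (ha : ∀ j, 0 ≤ a j) (hT : ∀ j, T (b j) = (a j : ℂ) • b j) : 0 ≤ T := by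
  have hsymm := ContinuousLinearMap.isSelfAdjoint_iff_isSymmetric.mp
    (isSelfAdjoint_of_apply_hilbertBasis b hT)
  refine (ContinuousLinearMap.nonneg_iff_isPositive T).mpr
    (ContinuousLinearMap.isPositive_def.mpr ⟨hsymm, fun x => ?_⟩)
  rw [ContinuousLinearMap.reApplyInnerSelf_apply]
  refine ((Complex.hasSum_iff _ _).mp (b.hasSum_inner_mul_inner (T x) x)).1.nonneg fun j => ?_
  have hinner : ⟪T x, b j⟫_ℂ = a j * ⟪x, b j⟫_ℂ := by
    rw [← inner_smul_right, ← hT]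
    exact hsymm x (b j)
  rw [hinner, ← inner_conj_symm x (b j), mul_assoc, ← Complex.normSq_eq_conj_mul_self,
    ← Complex.ofReal_mul, Complex.ofReal_re]
  exact mul_nonneg (ha j) (Complex.normSq_nonneg _)

theorem hasResidueTrace_iff_of_apply_hilbertBasis {κ : Type*} (b : HilbertBasis κ ℂ H)
    {T : H →L[ℂ] H} {a : κ → ℝ} (ha : ∀ j, 0 ≤ a j) (hT : ∀ j, T (b j) = (a j : ℂ) • b j)
    (t : ℝ≥0∞) :
    HasResidueTrace b T t ↔
      Tendsto (fun s : ℝ => ENNReal.ofReal (s - 1) * ∑' j, ENNReal.ofReal (a j ^ s))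
        (𝓝[>] 1) (𝓝 t) := by
  refine tendsto_congr' ?_
  filter_upwards [self_mem_nhdsWithin] with s hs
  congr 1
  refine tsum_congr fun j => ?_
  rw [rpow_apply_eigenvector (nonneg_of_apply_hilbertBasis b ha hT) (hT j)
    (zero_le_one.trans (le_of_lt hs)), inner_smul_right, inner_self_eq_norm_sq_to_K,
    b.orthonormal.norm_eq_one]
  simp

end Diagonal

theorem boundedInverse_blockDiag {ι : Type u} (a b : ι → Matrix (Fin 2) (Fin 2) ℂ)
    (hab : ∀ γ, a γ * b γ = 1) {K : ℝ} (hK : 0 ≤ K)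
    (hb : ∀ γ, ‖Matrix.toEuclideanCLM (𝕜 := ℂ) (b γ)‖ ≤ K) :
    boundedInverse (blockDiag a) =
      lp.mapCLM 2 (fun γ => Matrix.toEuclideanCLM (𝕜 := ℂ) (b γ)) hK hb := by
  have hright γ ψ : Matrix.toEuclideanCLM (𝕜 := ℂ) (a γ)
      (Matrix.toEuclideanCLM (𝕜 := ℂ) (b γ) ψ) = ψ := by
    rw [← mul_apply_eq_comp, ← map_mul, hab, map_one, one_apply_eq_self]
  have hleft γ ψ : Matrix.toEuclideanCLM (𝕜 := ℂ) (b γ)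
      (Matrix.toEuclideanCLM (𝕜 := ℂ) (a γ) ψ) = ψ := by
    rw [← mul_apply_eq_comp, ← map_mul, mul_eq_one_comm.mp (hab γ), map_one, one_apply_eq_self]
  refine boundedInverse_eq (fun ψ => ?_) fun φ => lp.ext (funext fun γ => hleft γ _)
  have hψ : (fun γ => Matrix.toEuclideanCLM (𝕜 := ℂ) (a γ)
      ((lp.mapCLM 2 (fun γ => Matrix.toEuclideanCLM (𝕜 := ℂ) (b γ)) hK hb ψ) γ)) = ψ :=
    funext fun γ => hright γ _
  exact ⟨(congrArg (Memℓp · 2) hψ).mpr (lp.memℓp ψ), lp.ext hψ⟩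

namespace BratteliDiagram

variable {B : BratteliDiagram.{u}} {w : B.Paths → ℝ}

theorem boundedInverse_dirac_stdBasis (hpos : ∀ γ, 0 < diam w γ) {K : ℝ}
    (hK : ∀ γ, diam w γ ≤ K) (γ : B.Paths) (i : Fin 2) :
    boundedInverse (dirac w) (stdBasis B.Paths (γ, i)) =
      (diam w γ : ℂ) • stdBasis B.Paths (γ, 1 - i) := by
  classical
  let σ : Matrix (Fin 2) (Fin 2) ℂ := !![0, 1; 1, 0]
  have hσ : σ * σ = 1 := by simp [σ, Matrix.one_fin_two]
  have hbound γ : ‖Matrix.toEuclideanCLM (𝕜 := ℂ) ((diam w γ : ℂ) • σ)‖ ≤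
      max K 0 * ‖Matrix.toEuclideanCLM (𝕜 := ℂ) σ‖ := by
    rw [map_smul, norm_smul, Complex.norm_real, Real.norm_of_nonneg (hpos γ).le]
    gcongr
    exact (hK γ).trans (le_max_left _ _)
  have hinv γ : (((1 / diam w γ : ℝ) : ℂ) • σ) * ((diam w γ : ℂ) • σ) = 1 := by
    rw [smul_mul_smul_comm, hσ, ← Complex.ofReal_mul, one_div_mul_cancel (hpos γ).ne',
      Complex.ofReal_one, one_smul]
  rw [dirac, boundedInverse_blockDiag _ _ hinv (by positivity) hbound, stdBasis_apply,
    stdBasis_apply]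
  refine lp.ext (funext fun γ' => ?_)
  change Matrix.toEuclideanCLM (𝕜 := ℂ) ((diam w γ' : ℂ) • σ) _ = _
  rw [lp.coeFn_smul, Pi.smul_apply, lp.single_apply, lp.single_apply]
  rcases eq_or_ne γ' γ with rfl | hne
  · ext j
    fin_cases i <;> fin_cases j <;>
      simp [σ, Matrix.ofLp_toEuclideanCLM, Matrix.mulVec, dotProduct]
  · simp [hne]

theorem absNegPow_dirac_stdBasis (hpos : ∀ γ, 0 < diam w γ) {K : ℝ} (hK : ∀ γ, diam w γ ≤ K)
    {δ : ℝ} (hδ : 0 ≤ δ) (p : B.Paths × Fin 2) :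
    absNegPow (dirac w) δ (stdBasis B.Paths p) =
      ((diam w p.1 ^ δ : ℝ) : ℂ) • stdBasis B.Paths p := by
  classical
  set R := boundedInverse (dirac w)
  have hRb : ∀ q : B.Paths × Fin 2,
      R (stdBasis B.Paths q) = (diam w q.1 : ℂ) • stdBasis B.Paths (q.1, 1 - q.2) :=
    fun q => boundedInverse_dirac_stdBasis hpos hK q.1 q.2
  have hsq : (star R * R) (stdBasis B.Paths p) =
      ((diam w p.1 ^ 2 : ℝ) : ℂ) • stdBasis B.Paths p := by
    refine eq_of_inner_hilbertBasis_eq (stdBasis B.Paths) fun q => ?_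
    rw [mul_apply_eq_comp, ContinuousLinearMap.star_eq_adjoint,
      ContinuousLinearMap.adjoint_inner_right, hRb, hRb, inner_smul_left, inner_smul_right,
      inner_smul_right, orthonormal_iff_ite.mp (stdBasis B.Paths).orthonormal,
      orthonormal_iff_ite.mp (stdBasis B.Paths).orthonormal]
    rcases eq_or_ne q p with rfl | hne
    · simp [sq]
    · have hne' : (q.1, 1 - q.2) ≠ (p.1, 1 - p.2) := by
        simpa [Prod.ext_iff] using hne
      simp [hne, hne']
  exact absNegPow_apply_eigenvector (hpos _).le hsq hδ

/-- The value of the choice function `τ` at a basis vector `δ_γ ⊗ e_i` of `ℓ²(FB, ℂ²)`: it is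
`τ₊ γ` for `i = 0` and `τ₋ γ` for `i = 1`. -/
def ChoiceFunction.value (τ : ChoiceFunction w) (p : B.Paths × Fin 2) : B.InfPath :=
  if p.2 = 0 then τ.plus p.1 else τ.minus p.1

theorem rep_cylinderChar_stdBasis (τ : ChoiceFunction w) (η : B.Paths) (p : B.Paths × Fin 2) :
    rep τ (cylinderChar η) (stdBasis B.Paths p) =
      (((cylinder η).indicator (fun _ => (1 : ℝ)) (τ.value p) : ℝ) : ℂ) • stdBasis B.Paths p := by
  classical
  obtain ⟨γ, i⟩ := p
  have hchar x : cylinderChar η x = (((cylinder η).indicator (fun _ => (1 : ℝ)) x : ℝ) : ℂ) := by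
    change (cylinder η).indicator (fun _ => (1 : ℂ)) x = _
    by_cases hx : x ∈ cylinder η <;> simp [hx]
  rw [stdBasis_apply]
  refine lp.ext (funext fun γ' => ?_)
  change Matrix.toEuclideanCLM (𝕜 := ℂ) _ _ = _
  rw [lp.coeFn_smul, Pi.smul_apply, lp.single_apply, hchar, hchar]
  rcases eq_or_ne γ' γ with rfl | hne
  · ext j
    fin_cases i <;> fin_cases j <;>
      simp [ChoiceFunction.value, Matrix.ofLp_toEuclideanCLM, Matrix.mulVec, dotProduct]
  · simp [hne]

/-- The measure on the path space whose value on `[η]` is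
`(s - 1) Tr ((π_τ(χ_[η]) |D|^{-δ}) ^ s)`: a sum of point masses at the values of `τ`. -/
def traceMeasure (τ : ChoiceFunction w) (δ s : ℝ) : Measure B.InfPath :=
  ENNReal.ofReal (s - 1) • Measure.sum fun γ =>
    ENNReal.ofReal (diam w γ ^ (δ * s)) •
      (Measure.dirac (τ.plus γ) + Measure.dirac (τ.minus γ))

theorem traceMeasure_cylinder (τ : ChoiceFunction w) (δ s : ℝ) (η : B.Paths) :
    traceMeasure τ δ s (cylinder η) = ENNReal.ofReal (s - 1) *
      ∑' γ, ENNReal.ofReal (diam w γ ^ (δ * s)) *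
        ((cylinder η).indicator 1 (τ.plus γ) + (cylinder η).indicator 1 (τ.minus γ)) := by
  have hη := measurableSet_cylinder η
  simp only [traceMeasure, Measure.smul_apply, Measure.sum_apply _ hη, Measure.add_apply,
    Measure.dirac_apply' _ hη, smul_eq_mul]

theorem hasDixmierValue_iff (hpos : ∀ γ, 0 < diam w γ) {K : ℝ} (hK : ∀ γ, diam w γ ≤ K) {δ : ℝ}
    (hδ : 0 ≤ δ) (τ : ChoiceFunction w) (η : B.Paths) (t : ℝ≥0∞) :
    HasDixmierValue τ δ η t ↔
      Tendsto (fun s => traceMeasure τ δ s (cylinder η)) (𝓝[>] 1) (𝓝 t) := by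
  have hdiag p : (rep τ (cylinderChar η) * absNegPow (dirac w) δ) (stdBasis B.Paths p) =
      (((cylinder η).indicator (fun _ => (1 : ℝ)) (τ.value p) * diam w p.1 ^ δ : ℝ) : ℂ) •
        stdBasis B.Paths p := by
    rw [mul_apply_eq_comp, absNegPow_dirac_stdBasis hpos hK hδ, map_smul,
      rep_cylinderChar_stdBasis, smul_smul, mul_comm, Complex.ofReal_mul]
  have hnonneg (p : B.Paths × Fin 2) :
      0 ≤ (cylinder η).indicator (fun _ => (1 : ℝ)) (τ.value p) * diam w p.1 ^ δ :=
    mul_nonneg (Set.indicator_nonneg (by simp) _) (Real.rpow_nonneg (hpos _).le _)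
  rw [HasDixmierValue, hasResidueTrace_iff_of_apply_hilbertBasis _ hnonneg hdiag]
  refine tendsto_congr' ?_
  filter_upwards [self_mem_nhdsWithin] with s hs
  have hs0 : s ≠ 0 := (zero_lt_one.trans hs).ne'
  have hterm γ x : ENNReal.ofReal (((cylinder η).indicator (fun _ => (1 : ℝ)) x *
      diam w γ ^ δ) ^ s) =
        ENNReal.ofReal (diam w γ ^ (δ * s)) * (cylinder η).indicator 1 x := by
    by_cases hx : x ∈ cylinder η
    · simp [hx, Real.rpow_mul (hpos γ).le]
    · simp [hx, Real.zero_rpow hs0]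
  rw [traceMeasure_cylinder, ENNReal.tsum_prod']
  congr 1
  refine tsum_congr fun γ => ?_
  rw [tsum_fintype, Fin.sum_univ_two, hterm, hterm, mul_add]
  rfl

end BratteliDiagram

/-! ## Stationary Bratteli diagrams -/

section LevelProd

variable {k : ℕ} [NeZero k]

theorem finOfNat_add_left (n : ℕ) : Fin.ofNat k (k + n) = Fin.ofNat k n :=
  Fin.ext (Nat.add_mod_left k n)

theorem finOfNat_val (i : Fin k) : Fin.ofNat k (i : ℕ) = i :=
  Fin.ext (Nat.mod_eq_of_lt i.2)

/-- The product of the eigenvalues attached to the first `n` levels of a stationary `k`-Bratteli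
diagram, where `ρ i` is attached to the levels congruent to `i` modulo `k`. -/
def levelProd (ρ : Fin k → ℝ) (n : ℕ) : ℝ := ∏ j ∈ Finset.range n, ρ (Fin.ofNat k j)

theorem levelProd_eq_prod_pow (ρ : Fin k → ℝ) (n : ℕ) :
    levelProd ρ n = ∏ i : Fin k, ρ i ^ (if (i : ℕ) < n % k then n / k + 1 else n / k) := by
  rw [levelProd, ← Finset.prod_fiberwise' _ (Fin.ofNat k) ρ]
  refine Finset.prod_congr rfl fun i _ => ?_
  have hmod (j : ℕ) : Fin.ofNat k j = i ↔ j ≡ i [MOD k] := by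
    rw [Fin.ext_iff, Fin.val_ofNat, Nat.ModEq, Nat.mod_eq_of_lt i.2]
  simp only [hmod]
  rw [Finset.prod_const, ← Nat.count_eq_card_filter_range,
    Nat.count_modEq_card n (NeZero.pos k), Nat.mod_eq_of_lt i.2, add_ite, add_zero]

theorem levelProd_pos {ρ : Fin k → ℝ} (hρ : ∀ i, 0 < ρ i) (n : ℕ) : 0 < levelProd ρ n :=
  Finset.prod_pos fun _ _ => hρ _

theorem levelProd_period_add (ρ : Fin k → ℝ) (n : ℕ) :
    levelProd ρ (k + n) = (∏ i, ρ i) * levelProd ρ n := by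
  simp only [levelProd, Finset.prod_range_add, finOfNat_add_left]
  simp only [Finset.prod_range, finOfNat_val]

theorem levelProd_mul_period_add (ρ : Fin k → ℝ) (q n : ℕ) :
    levelProd ρ (q * k + n) = (∏ i, ρ i) ^ q * levelProd ρ n := by
  induction q with
  | zero => simp
  | succ q ih =>
    rw [show (q + 1) * k + n = k + (q * k + n) by ring, levelProd_period_add, ih, pow_succ',
      mul_assoc]

end LevelProd

section PathCount

open BratteliDiagram

variable {k : ℕ} [NeZero k] {ι : Type u} [Fintype ι] (A : Fin k → Matrix ι ι ℕ)

/-- The edges of `stationaryBratteli A` with a given range are counted by a row of the matrix. -/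
def stationaryBratteliEdgeEquiv (n : ℕ) (p : ι) :
    {e : (stationaryBratteli A).E n // (stationaryBratteli A).r e = p} ≃
      Σ q : ι, Fin (A (Fin.ofNat k n) p q) where
  toFun e := e.2 ▸ e.1.2
  invFun e := ⟨⟨p, e⟩, rfl⟩
  left_inv := by
    rintro ⟨⟨p', e⟩, rfl⟩
    rfl
  right_inv _ := rfl

theorem sum_finPath_succ {n : ℕ} (F : (stationaryBratteli A).FinPath n → ℝ) (f : ι → ℝ) :
    ∑ γ : (stationaryBratteli A).FinPath (n + 1), F (γ.restrict n.le_succ) * f γ.source =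
      ∑ γ, F γ * ((A (Fin.ofNat k n)).map (Nat.cast : ℕ → ℝ)).mulVec f γ.source := by
  let e := (FinPath.succEquiv (stationaryBratteli A) n).trans
    (Equiv.sigmaCongrRight fun γ => stationaryBratteliEdgeEquiv A n γ.source)
  have hrestrict p : (e.symm p).restrict n.le_succ = p.1 :=
    FinPath.restrict_snoc p.1 ⟨p.1.source, p.2⟩ rfl
  have hsource p : (e.symm p).source = p.2.1 := FinPath.source_snoc p.1 ⟨p.1.source, p.2⟩ rfl
  rw [← e.symm.sum_comp]
  simp only [hrestrict, hsource, Fintype.sum_sigma, Finset.sum_const, Finset.card_univ,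
    Fintype.card_fin, nsmul_eq_mul, Matrix.mulVec, dotProduct, Finset.mul_sum, mul_left_comm]
  rfl

variable [DecidableEq ι]

/-- The matrix counting the paths of length `j` from level `m` to level `m + j` of
`stationaryBratteli A`. -/
def pathCount (m : ℕ) : ℕ → Matrix ι ι ℝ
  | 0 => 1
  | j + 1 => pathCount m j * (A (Fin.ofNat k (m + j))).map (Nat.cast : ℕ → ℝ)

open Classical in
theorem sum_extensions {m : ℕ} (η : (stationaryBratteli A).FinPath m) (j : ℕ) (f : ι → ℝ) :
    ∑ γ : (stationaryBratteli A).FinPath (m + j) with γ.restrict (m.le_add_right j) = η,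
      f γ.source = (pathCount A m j).mulVec f η.source := by
  rw [Finset.sum_filter]
  induction j generalizing f with
  | zero =>
    rw [pathCount, Matrix.one_mulVec]
    exact Fintype.sum_ite_eq' η fun γ => f γ.source
  | succ j ih =>
    rw [pathCount, ← Matrix.mulVec_mulVec, ← ih]
    have hsucc := sum_finPath_succ A (fun γ : (stationaryBratteli A).FinPath (m + j) =>
      if γ.restrict (m.le_add_right j) = η then 1 else 0) f
    simp only [ite_mul, one_mul, zero_mul] at hsucc
    exact hsucc

theorem pathCount_nonneg (m j : ℕ) (p q : ι) : 0 ≤ pathCount A m j p q := by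
  induction j generalizing q with
  | zero =>
    rw [pathCount, Matrix.one_apply]
    split_ifs <;> simp
  | succ j ih => exact Finset.sum_nonneg fun l _ => mul_nonneg (ih l) (Nat.cast_nonneg _)

theorem pathCount_add (m a b : ℕ) :
    pathCount A m (a + b) = pathCount A m a * pathCount A (m + a) b := by
  induction b with
  | zero => simp only [add_zero, pathCount, mul_one]
  | succ b ih => rw [← add_assoc, pathCount, pathCount, ih, Matrix.mul_assoc, add_assoc]

theorem pathCount_period_add (m j : ℕ) : pathCount A (k + m) j = pathCount A m j := by
  induction j with
  | zero => rfl
  | succ j ih => rw [pathCount, pathCount, ih, add_assoc, finOfNat_add_left]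

theorem pathCount_mul_period_add (m q t : ℕ) :
    pathCount A m (q * k + t) = pathCount A m k ^ q * pathCount A m t := by
  induction q with
  | zero => simp
  | succ q ih =>
    rw [show (q + 1) * k + t = k + (q * k + t) by ring, pathCount_add, add_comm m,
      pathCount_period_add, ih, pow_succ', Matrix.mul_assoc]

variable {A} {ρ : Fin k → ℝ} {x : ι → ℝ}

theorem pathCount_mulVec (hx : ∀ i, ((A i).map (Nat.cast : ℕ → ℝ)).mulVec x = ρ i • x)
    (m j : ℕ) : levelProd ρ m • (pathCount A m j).mulVec x = levelProd ρ (m + j) • x := by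
  induction j with
  | zero => simp only [pathCount, Matrix.one_mulVec, add_zero]
  | succ j ih =>
    rw [pathCount, ← Matrix.mulVec_mulVec, hx, Matrix.mulVec_smul, smul_comm, ih, smul_smul,
      levelProd, levelProd, ← add_assoc, Finset.prod_range_succ, mul_comm]

theorem pathCount_period_mulVec (hρ : ∀ i, 0 < ρ i)
    (hx : ∀ i, ((A i).map (Nat.cast : ℕ → ℝ)).mulVec x = ρ i • x) (m : ℕ) :
    (pathCount A m k).mulVec x = (∏ i, ρ i) • x := by
  have h := pathCount_mulVec hx m k
  rw [add_comm, levelProd_period_add, mul_comm, ← smul_smul] at h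
  exact smul_right_injective (ι → ℝ) (levelProd_pos hρ m).ne' h

end PathCount

section ExtensionSum

variable {k : ℕ} [NeZero k] {ι : Type u} [Fintype ι] [DecidableEq ι]

/-- The sum of `w_δ(γ) ^ (δ s)` over the extensions `γ` by `j` edges of a path of length `m` with
source `p`. -/
def extensionSum (A : Fin k → Matrix ι ι ℕ) (ρ : Fin k → ℝ) (x : ι → ℝ) (δ : ℝ) (m : ℕ) (p : ι)
    (s : ℝ) (j : ℕ) : ℝ :=
  levelProd ρ (m + j) ^ (-s) * (pathCount A m j).mulVec (fun v => x v ^ (δ * s)) p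

/-- The matrix of the paths from level `m` to level `m + k`, normalised to have spectral
radius `1`. -/
def periodMatrix (A : Fin k → Matrix ι ι ℕ) (ρ : Fin k → ℝ) (m : ℕ) : Matrix ι ι ℝ :=
  (∏ i, ρ i)⁻¹ • pathCount A m k

/-- The coefficients of the geometric series to which the sums over the levels congruent to `t`
modulo `k` reduce. -/
def periodCoeff (A : Fin k → Matrix ι ι ℕ) (ρ : Fin k → ℝ) (m : ℕ) (p : ι) (t : ℕ) (v : ι)
    (q : ℕ) : ℝ :=
  (periodMatrix A ρ m ^ q).mulVec ((pathCount A m t).col v) p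

variable {A : Fin k → Matrix ι ι ℕ} {ρ : Fin k → ℝ} {x : ι → ℝ}

theorem extensionSum_nonneg (hρ : ∀ i, 0 < ρ i) (hx0 : ∀ p, 0 < x p) (δ : ℝ) (m : ℕ) (p : ι)
    (s : ℝ) (j : ℕ) : 0 ≤ extensionSum A ρ x δ m p s j :=
  mul_nonneg (Real.rpow_nonneg (levelProd_pos hρ _).le _) <| Finset.sum_nonneg fun v _ =>
    mul_nonneg (pathCount_nonneg A m j p v) (Real.rpow_nonneg (hx0 v).le _)

theorem pathCount_eq_mul_periodCoeff (hR : ∏ i, ρ i ≠ 0) (m : ℕ) (p v : ι) (q t : ℕ) :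
    pathCount A m (q * k + t) p v = (∏ i, ρ i) ^ q * periodCoeff A ρ m p t v q := by
  have hpow : pathCount A m k ^ q = (∏ i, ρ i) ^ q • periodMatrix A ρ m ^ q := by
    rw [periodMatrix, smul_pow, smul_smul, ← mul_pow, mul_inv_cancel₀ hR, one_pow, one_smul]
  rw [pathCount_mul_period_add, hpow, Matrix.smul_mul]
  rfl

theorem extensionSum_mul_period_add (hρ : ∀ i, 0 < ρ i) (δ : ℝ) (m : ℕ) (p : ι) (s : ℝ)
    (q t : ℕ) :
    extensionSum A ρ x δ m p s (q * k + t) = levelProd ρ (m + t) ^ (-s) *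
      ∑ v, x v ^ (δ * s) * (((∏ i, ρ i) ^ (1 - s)) ^ q * periodCoeff A ρ m p t v q) := by
  have hR : 0 < ∏ i, ρ i := Finset.prod_pos fun i _ => hρ i
  set R := ∏ i, ρ i with hRdef
  have hlevel : levelProd ρ (m + (q * k + t)) ^ (-s) =
      (R ^ q) ^ (-s) * levelProd ρ (m + t) ^ (-s) := by
    rw [add_left_comm, levelProd_mul_period_add,
      Real.mul_rpow (pow_nonneg hR.le q) (levelProd_pos hρ _).le]
  have hratio : (R ^ (1 - s)) ^ q = R ^ q * (R ^ q) ^ (-s) := by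
    rw [Real.rpow_pow_comm hR.le, sub_eq_add_neg, Real.rpow_add (pow_pos hR q), Real.rpow_one]
  rw [extensionSum, hlevel, hratio, mul_comm (_ ^ _), mul_assoc, Matrix.mulVec, dotProduct,
    Finset.mul_sum]
  congr 1
  refine Finset.sum_congr rfl fun v _ => ?_
  rw [pathCount_eq_mul_periodCoeff hR.ne', ← hRdef]
  ring

variable (hρ : ∀ i, 0 < ρ i) (hx0 : ∀ p, 0 < x p)
  (hx : ∀ i, ((A i).map (Nat.cast : ℕ → ℝ)).mulVec x = ρ i • x)

include hρ hx0 hx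

theorem exists_norm_periodMatrix_pow_mulVec_le (m : ℕ) (f : ι → ℝ) :
    ∃ C, ∀ q : ℕ, ‖(periodMatrix A ρ m ^ q).mulVec f‖ ≤ C := by
  have hR : 0 < ∏ i, ρ i := Finset.prod_pos fun i _ => hρ i
  refine exists_norm_pow_mulVec_le (fun i j => ?_) hx0 ?_ f
  · exact mul_nonneg (inv_nonneg.mpr hR.le) (pathCount_nonneg A m k i j)
  · rw [periodMatrix, Matrix.smul_mulVec, pathCount_period_mulVec hρ hx, inv_smul_smul₀ hR.ne']

variable (hR : 1 < ∏ i, ρ i) (δ : ℝ) (m : ℕ) (p : ι)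

include hR

theorem hasSum_extensionSum_mul_period_add {s : ℝ} (hs : 1 < s) (t : ℕ) :
    HasSum (fun q => extensionSum A ρ x δ m p s (q * k + t)) (levelProd ρ (m + t) ^ (-s) *
      ∑ v, x v ^ (δ * s) * ∑' q, ((∏ i, ρ i) ^ (1 - s)) ^ q * periodCoeff A ρ m p t v q) := by
  simp only [extensionSum_mul_period_add hρ]
  refine (hasSum_sum fun v _ => (Summable.hasSum ?_).mul_left _).mul_left _
  obtain ⟨C, hC⟩ :=
    exists_norm_periodMatrix_pow_mulVec_le hρ hx0 hx m ((pathCount A m t).col v)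
  exact summable_geometric_smul (fun q => (norm_le_pi_norm _ p).trans (hC q))
    (Real.rpow_nonneg (zero_lt_one.trans hR).le _)
    (Real.rpow_lt_one_of_one_lt_of_neg hR (sub_neg.mpr hs))

theorem exists_tendsto_tsum_extensionSum_mul_period_add (t : ℕ) :
    ∃ L : ℝ, Tendsto (fun s => (s - 1) * ∑' q, extensionSum A ρ x δ m p s (q * k + t))
      (𝓝[>] 1) (𝓝 L) := by
  have hmean (v : ι) := exists_tendsto_abelMean_mulVec
    (exists_norm_periodMatrix_pow_mulVec_le hρ hx0 hx m) ((pathCount A m t).col v) p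
  choose L hL using hmean
  have hrpow {a : ℝ} (ha : 0 < a) (b : ℝ) :
      Tendsto (fun s : ℝ => a ^ (b * s)) (𝓝[>] 1) (𝓝 (a ^ (b * 1))) :=
    (((Real.continuous_const_rpow ha.ne').comp (continuous_const_mul b)).tendsto 1).mono_left
      nhdsWithin_le_nhds
  refine ⟨_, ((hrpow (levelProd_pos hρ (m + t)) (-1)).mul (tendsto_finsetSum Finset.univ
    fun v _ => (hrpow (hx0 v) δ).mul (tendsto_sub_one_mul_tsum (hL v) hR))).congr' ?_⟩
  filter_upwards [self_mem_nhdsWithin] with s hs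
  rw [(hasSum_extensionSum_mul_period_add hρ hx0 hx hR δ m p hs t).tsum_eq, neg_one_mul,
    mul_left_comm (s - 1)]
  congr 1
  rw [Finset.mul_sum]
  exact Finset.sum_congr rfl fun v _ => mul_left_comm (x v ^ (δ * s)) (s - 1) _

theorem exists_tendsto_tsum_extensionSum :
    ∃ L : ℝ≥0∞, L ≠ ∞ ∧ Tendsto (fun s : ℝ => ENNReal.ofReal (s - 1) *
      ∑' j, ENNReal.ofReal (extensionSum A ρ x δ m p s j)) (𝓝[>] 1) (𝓝 L) := by
  choose L hL using fun t : Fin k =>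
    exists_tendsto_tsum_extensionSum_mul_period_add hρ hx0 hx hR δ m p t
  refine ⟨∑ t, ENNReal.ofReal (L t), ENNReal.sum_ne_top.mpr fun _ _ => ENNReal.ofReal_ne_top,
    (tendsto_finsetSum Finset.univ fun t _ => ENNReal.tendsto_ofReal (hL t)).congr' ?_⟩
  filter_upwards [self_mem_nhdsWithin] with s hs
  rw [← (Nat.divModEquiv k).symm.tsum_eq, ENNReal.tsum_prod', ENNReal.tsum_comm, tsum_fintype,
    Finset.mul_sum]
  refine Finset.sum_congr rfl fun t _ => ?_
  simp only [Nat.divModEquiv_symm_apply]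
  rw [ENNReal.ofReal_mul (sub_nonneg.mpr (le_of_lt hs)), ENNReal.ofReal_tsum_of_nonneg
    (fun q => extensionSum_nonneg hρ hx0 δ m p s _)
    (hasSum_extensionSum_mul_period_add hρ hx0 hx hR δ m p hs t).summable]

end ExtensionSum

namespace BratteliDiagram

variable {B : BratteliDiagram.{u}} {w : B.Paths → ℝ}

theorem exists_take_ne_of_diam_pos {η : B.Paths} (h : 0 < diam w η) :
    ∃ y ∈ cylinder η, ∃ z ∈ cylinder η, ∃ n, ∀ N, n < N → y.take N ≠ z.take N := by
  obtain ⟨y, hy, z, hz, hyz⟩ : ∃ y ∈ cylinder η, ∃ z ∈ cylinder η, y ≠ z := by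
    by_contra! hall
    refine h.not_ge (Real.sSup_le ?_ le_rfl)
    rintro _ ⟨y, hy, z, hz, rfl⟩
    rw [dist, if_pos (hall y hy z hz)]
  obtain ⟨n, hn⟩ := Function.ne_iff.mp (Subtype.coe_injective.ne hyz)
  exact ⟨y, hy, z, hz, n, fun N hN heq =>
    hn (congrArg (fun γ : B.FinPath N => γ.edge ⟨n, hN⟩) heq)⟩

theorem ChoiceFunction.indicator_add_indicator (τ : ChoiceFunction w) {m n : ℕ} (h : m ≤ n)
    (γ : B.FinPath n) (η : B.FinPath m) [Decidable (γ.restrict h = η)] :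
    (cylinder ⟨m, η⟩).indicator 1 (τ.plus ⟨n, γ⟩) + (cylinder ⟨m, η⟩).indicator 1 (τ.minus ⟨n, γ⟩) =
      if γ.restrict h = η then (2 : ℝ≥0∞) else 0 := by
  classical
  simp only [Set.indicator_apply, mem_cylinder_iff_restrict_eq h (τ.plus_mem ⟨n, γ⟩),
    mem_cylinder_iff_restrict_eq h (τ.minus_mem ⟨n, γ⟩), Pi.one_apply]
  split_ifs
  · exact one_add_one_eq_two
  · exact add_zero 0

theorem tsum_paths_eq_sum_add_tsum (f : B.Paths → ℝ≥0∞) (m : ℕ) :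
    ∑' γ, f γ = ∑ n ∈ Finset.range m, ∑ γ : B.FinPath n, f ⟨n, γ⟩ +
      ∑' j, ∑ γ : B.FinPath (m + j), f ⟨m + j, γ⟩ := by
  let F n := ∑ γ : B.FinPath n, f ⟨n, γ⟩
  calc ∑' γ, f γ = ∑' n, F n := by
        rw [ENNReal.tsum_sigma']
        exact tsum_congr fun n => tsum_fintype _
    _ = ∑ n ∈ Finset.range m, F n + ∑' j, F (j + m) :=
        (ENNReal.summable.sum_add_tsum_nat_add').symm
    _ = _ := by simp only [add_comm _ m, F]

theorem tendsto_sub_one_mul_sum_levels (hpos : ∀ γ, 0 < diam w γ) (δ : ℝ)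
    (c : B.Paths → ℝ≥0∞) (hc : ∀ γ, c γ ≠ ∞) (m : ℕ) :
    Tendsto (fun s : ℝ => ENNReal.ofReal (s - 1) * ∑ n ∈ Finset.range m, ∑ γ : B.FinPath n,
      ENNReal.ofReal (diam w ⟨n, γ⟩ ^ (δ * s)) * c ⟨n, γ⟩) (𝓝[>] 1) (𝓝 0) := by
  have hterm (γ : B.Paths) : Tendsto (fun s : ℝ => ENNReal.ofReal (s - 1) *
      (ENNReal.ofReal (diam w γ ^ (δ * s)) * c γ)) (𝓝[>] 1) (𝓝 0) := by
    have hcont : Continuous fun s : ℝ => (s - 1) * diam w γ ^ (δ * s) :=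
      (continuous_sub_right 1).mul
        ((Real.continuous_const_rpow (hpos γ).ne').comp (continuous_const_mul δ))
    have hlim := ENNReal.Tendsto.mul_const (ENNReal.tendsto_ofReal
      ((hcont.tendsto 1).mono_left (nhdsWithin_le_nhds (s := Set.Ioi 1)))) (Or.inr (hc γ))
    simp only [sub_self, zero_mul, ENNReal.ofReal_zero] at hlim
    refine hlim.congr' ?_
    filter_upwards [self_mem_nhdsWithin] with s hs
    rw [ENNReal.ofReal_mul (sub_nonneg.mpr (le_of_lt hs)), mul_assoc]
  simp only [Finset.mul_sum]
  simpa only [Finset.sum_const_zero] using tendsto_finsetSum (Finset.range m) fun n _ =>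
    tendsto_finsetSum Finset.univ fun (γ : B.FinPath n) _ => hterm ⟨n, γ⟩

end BratteliDiagram

section StationaryWeight

open BratteliDiagram

variable {k : ℕ} [NeZero k] {ι : Type u} [Fintype ι]

/-- The weight `w_δ` on the finite paths of `stationaryBratteli A`, for arbitrary eigenvalues `ρ i`
and an arbitrary common eigenvector `x`. -/
def stationaryWeight (A : Fin k → Matrix ι ι ℕ) (ρ : Fin k → ℝ) (x : ι → ℝ) (δ : ℝ)
    (η : (stationaryBratteli A).Paths) : ℝ :=
  levelProd ρ η.1 ^ (-1 / δ) * x η.2.source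

variable {A : Fin k → Matrix ι ι ℕ} {ρ : Fin k → ℝ} {x : ι → ℝ} {δ : ℝ}

theorem stationaryWeight_pos (hρ : ∀ i, 0 < ρ i) (hx0 : ∀ p, 0 < x p)
    (η : (stationaryBratteli A).Paths) : 0 < stationaryWeight A ρ x δ η :=
  mul_pos (Real.rpow_pos_of_pos (levelProd_pos hρ _) _) (hx0 _)

theorem stationaryWeight_rpow (hρ : ∀ i, 0 < ρ i) (hx0 : ∀ p, 0 < x p) (hδ : δ ≠ 0) (s : ℝ)
    (η : (stationaryBratteli A).Paths) :
    stationaryWeight A ρ x δ η ^ (δ * s) = levelProd ρ η.1 ^ (-s) * x η.2.source ^ (δ * s) := by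
  have hlevel := (levelProd_pos hρ η.1).le
  rw [stationaryWeight]
  have hsource : 0 < x η.2.source := hx0 _
  generalize x η.2.source = a at hsource ⊢
  rw [Real.mul_rpow (Real.rpow_nonneg hlevel _) hsource.le, ← Real.rpow_mul hlevel, ← mul_assoc,
    div_mul_cancel₀ _ hδ, neg_one_mul]

theorem exists_stationaryWeight_le (hρ : ∀ i, 0 < ρ i) (hR : 1 ≤ ∏ i, ρ i)
    (hx0 : ∀ p, 0 < x p) (hδ : 0 < δ) : ∃ K, ∀ η, stationaryWeight A ρ x δ η ≤ K := by
  obtain ⟨K, hK⟩ := (Set.finite_range fun a : Fin k × ι =>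
    levelProd ρ a.1 ^ (-1 / δ) * x a.2).bddAbove
  refine ⟨K, fun ⟨n, γ⟩ => le_trans ?_ (hK ⟨(Fin.ofNat k n, γ.source), rfl⟩)⟩
  have hmod : levelProd ρ (n % k) ≤ levelProd ρ n := by
    conv_rhs => rw [← Nat.div_add_mod' n k, levelProd_mul_period_add]
    exact le_mul_of_one_le_left (levelProd_pos hρ _).le (one_le_pow₀ hR)
  exact mul_le_mul_of_nonneg_right (Real.rpow_le_rpow_of_nonpos (levelProd_pos hρ _) hmod
    (div_nonpos_of_nonpos_of_nonneg (neg_nonpos.mpr zero_le_one) hδ.le)) (hx0 _).le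

variable (hx0 : ∀ p, 0 < x p) (hx : ∀ i, ((A i).map (Nat.cast : ℕ → ℝ)).mulVec x = ρ i • x)

include hx0 hx

theorem eigenvalue_pos_of_infPath (y : (stationaryBratteli A).InfPath) (i : Fin k) : 0 < ρ i := by
  obtain ⟨p, q, e⟩ : Σ p : ι, Σ q : ι, Fin (A (Fin.ofNat k i) p q) := y.1 i
  rw [finOfNat_val] at e
  have hrow : 0 < ((A i).map (Nat.cast : ℕ → ℝ)).mulVec x p :=
    Finset.sum_pos' (fun l _ => mul_nonneg (Nat.cast_nonneg _) (hx0 l).le)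
      ⟨q, Finset.mem_univ q, mul_pos (Nat.cast_pos.mpr e.pos) (hx0 q)⟩
  rw [hx] at hrow
  exact pos_of_mul_pos_left hrow (hx0 p).le

theorem levelProd_mul_add_le (hρ : ∀ i, 0 < ρ i) {m n : ℕ} {η : (stationaryBratteli A).FinPath m}
    {γ γ' : (stationaryBratteli A).FinPath (m + n)} (hγ : γ.restrict (m.le_add_right n) = η)
    (hγ' : γ'.restrict (m.le_add_right n) = η) (hne : γ ≠ γ') :
    levelProd ρ m * (x γ.source + x γ'.source) ≤ levelProd ρ (m + n) * x η.source := by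
  classical
  let extensions := Finset.univ.filter fun ξ : (stationaryBratteli A).FinPath (m + n) =>
    ξ.restrict (m.le_add_right n) = η
  have hsub : {γ, γ'} ⊆ extensions := by
    simp [extensions, Finset.insert_subset_iff, hγ, hγ']
  have hsum : x γ.source + x γ'.source ≤ ∑ ξ ∈ extensions, x ξ.source := by
    rw [← Finset.sum_pair (f := fun ξ : (stationaryBratteli A).FinPath (m + n) => x ξ.source) hne]
    exact Finset.sum_le_sum_of_subset_of_nonneg hsub fun ξ _ _ => (hx0 _).le
  calc levelProd ρ m * (x γ.source + x γ'.source)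
    _ ≤ levelProd ρ m * ∑ ξ ∈ extensions, x ξ.source :=
        mul_le_mul_of_nonneg_left hsum (levelProd_pos hρ m).le
    _ = levelProd ρ m * (pathCount A m n).mulVec x η.source :=
        congrArg (levelProd ρ m * ·) (sum_extensions A η n x)
    _ = levelProd ρ (m + n) * x η.source := congrFun (pathCount_mulVec hx m n) _

end StationaryWeight

namespace BratteliDiagram

variable {B : BratteliDiagram.{u}}

/-- The path of length `0` at a vertex of level `0`. -/
def vertexPath (v : B.V 0) : B.FinPath 0 where
  root := v
  edge i := i.elim0
  root_eq h := absurd h (lt_irrefl 0)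
  compat _ h := absurd h (Nat.not_lt_zero _)

theorem exists_measure_cylinder_eq {w : B.Paths → ℝ} (τ : ChoiceFunction w) {δ : ℝ}
    {t : B.Paths → ℝ≥0∞} (ht : ∀ η, t η ≠ ∞)
    (h : ∀ η, Tendsto (fun s => traceMeasure τ δ s (cylinder η)) (𝓝[>] 1) (𝓝 (t η))) :
    ∃ μ : Measure B.InfPath, IsFiniteMeasure μ ∧ ∀ η, μ (cylinder η) = t η := by
  have hmass : Tendsto (fun s => traceMeasure τ δ s Set.univ) (𝓝[>] 1)
      (𝓝 (∑ γ : B.FinPath 0, t ⟨0, γ⟩)) := by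
    simp only [measure_univ_eq_sum_cylinder _ 0]
    exact tendsto_finsetSum _ fun γ _ => h ⟨0, γ⟩
  obtain ⟨μ, hfinite, hμ⟩ := exists_measure_of_tendsto_isClopen
    borel_infPath_eq_generateFrom_isClopen (ENNReal.sum_ne_top.mpr fun _ _ => ht _) hmass
  exact ⟨μ, hfinite, fun η => hμ _ (isClopen_cylinder η) _ (h η)⟩

end BratteliDiagram

section StationaryLimit

open BratteliDiagram

variable {k : ℕ} [NeZero k] {ι : Type u} [Fintype ι]
variable {A : Fin k → Matrix ι ι ℕ} {ρ : Fin k → ℝ} {x : ι → ℝ} {δ : ℝ}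

theorem eigenvalue_pos_of_diam_pos [Nonempty ι] {w : (stationaryBratteli A).Paths → ℝ}
    (hw : ∀ v, 0 < diam w ⟨0, v⟩) (hx0 : ∀ p, 0 < x p)
    (hx : ∀ i, ((A i).map (Nat.cast : ℕ → ℝ)).mulVec x = ρ i • x) (i : Fin k) : 0 < ρ i := by
  inhabit ι
  obtain ⟨y, -⟩ := exists_take_ne_of_diam_pos (hw (vertexPath (default : ι)))
  exact eigenvalue_pos_of_infPath hx0 hx y i

theorem one_lt_prod_eigenvalue_of_diam_pos [Nonempty ι] {w : (stationaryBratteli A).Paths → ℝ}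
    (hw : ∀ v, 0 < diam w ⟨0, v⟩) (hx0 : ∀ p, 0 < x p)
    (hx : ∀ i, ((A i).map (Nat.cast : ℕ → ℝ)).mulVec x = ρ i • x) : 1 < ∏ i, ρ i := by
  -- At a vertex where `x` is minimal, two distinct paths of the same length double the mass of `x`.
  obtain ⟨v, hv⟩ := Finite.exists_min x
  obtain ⟨y, hy, z, hz, n, hne⟩ := exists_take_ne_of_diam_pos (hw (vertexPath v))
  have hρ := eigenvalue_pos_of_diam_pos hw hx0 hx
  have hlt : n < 0 + (n + 1) * k := by
    rw [zero_add]
    exact Nat.le_mul_of_pos_right (n + 1) (NeZero.pos k)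
  have hle : levelProd ρ 0 * (x _ + x _) ≤ levelProd ρ (0 + (n + 1) * k) * x v :=
    levelProd_mul_add_le hx0 hx hρ (γ := y.take _) (γ' := z.take _) hy hz (hne _ hlt)
  have hzero : levelProd ρ 0 = 1 := Finset.prod_range_zero _
  have hperiods : levelProd ρ (0 + (n + 1) * k) = (∏ i, ρ i) ^ (n + 1) := by
    rw [add_comm, levelProd_mul_period_add, hzero, mul_one]
  rw [hperiods, hzero, one_mul] at hle
  have hpow : 1 < (∏ i, ρ i) ^ (n + 1) := by
    nlinarith [(add_le_add (hv _) (hv _)).trans hle, hx0 v]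
  exact (one_lt_pow_iff_of_nonneg (Finset.prod_nonneg fun i _ => (hρ i).le)
    n.succ_ne_zero).mp hpow

variable (hρ : ∀ i, 0 < ρ i) (hx0 : ∀ p, 0 < x p) (hδ : 0 < δ)

include hρ hx0 hδ

theorem sum_stationaryWeight_rpow_mul_indicator [DecidableEq ι]
    {w : (stationaryBratteli A).Paths → ℝ} (τ : ChoiceFunction w) {m : ℕ}
    (η : (stationaryBratteli A).FinPath m) (s : ℝ) (j : ℕ) :
    ∑ γ : (stationaryBratteli A).FinPath (m + j),
      ENNReal.ofReal (stationaryWeight A ρ x δ ⟨m + j, γ⟩ ^ (δ * s)) *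
        ((cylinder ⟨m, η⟩).indicator 1 (τ.plus ⟨m + j, γ⟩) +
          (cylinder ⟨m, η⟩).indicator 1 (τ.minus ⟨m + j, γ⟩)) =
      ENNReal.ofReal (extensionSum A ρ x δ m η.source s j) * 2 := by
  classical
  simp only [τ.indicator_add_indicator (m.le_add_right j), mul_ite, mul_zero]
  rw [← Finset.sum_filter, ← Finset.sum_mul, ← ENNReal.ofReal_sum_of_nonneg fun γ _ =>
    Real.rpow_nonneg (stationaryWeight_pos hρ hx0 _).le _]
  simp only [stationaryWeight_rpow hρ hx0 hδ.ne']
  rw [← Finset.mul_sum]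
  exact congrArg (fun a => ENNReal.ofReal (_ * a) * 2)
    (sum_extensions A η j fun v => x v ^ (δ * s))

theorem exists_tendsto_traceMeasure_cylinder
    (hx : ∀ i, ((A i).map (Nat.cast : ℕ → ℝ)).mulVec x = ρ i • x) (hR : 1 < ∏ i, ρ i)
    (hdiam : ∀ η, stationaryWeight A ρ x δ η = diam (stationaryWeight A ρ x δ) η)
    (η : (stationaryBratteli A).Paths) :
    ∃ t ≠ ∞, ∀ τ : ChoiceFunction (stationaryWeight A ρ x δ),
      Tendsto (fun s => traceMeasure τ δ s (cylinder η)) (𝓝[>] 1) (𝓝 t) := by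
  classical
  obtain ⟨m, η⟩ := η
  obtain ⟨L, hL, hlim⟩ := exists_tendsto_tsum_extensionSum hρ hx0 hx hR δ m η.source
  have hpos γ : 0 < diam (stationaryWeight A ρ x δ) γ := hdiam γ ▸ stationaryWeight_pos hρ hx0 γ
  refine ⟨0 + L * 2, ?_, fun τ => ?_⟩
  · rw [zero_add]
    exact ENNReal.mul_ne_top hL ENNReal.ofNat_ne_top
  have hfinite γ : (cylinder ⟨m, η⟩).indicator 1 (τ.plus γ) +
      (cylinder ⟨m, η⟩).indicator 1 (τ.minus γ) ≠ ∞ := by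
    simp only [Set.indicator_apply, Pi.one_apply]
    split_ifs <;> simp
  refine ((tendsto_sub_one_mul_sum_levels hpos δ _ hfinite m).add
    (ENNReal.Tendsto.mul_const hlim (Or.inr ENNReal.ofNat_ne_top))).congr fun s => ?_
  rw [traceMeasure_cylinder, tsum_paths_eq_sum_add_tsum _ m, mul_add, mul_assoc,
    ← ENNReal.tsum_mul_right]
  simp only [← sum_stationaryWeight_rpow_mul_indicator hρ hx0 hδ τ, hdiam]

end StationaryLimit

open BratteliDiagram in
theorem proposition3p15_general {k : ℕ} [NeZero k] {ι : Type u} [Fintype ι]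
    {A : Fin k → Matrix ι ι ℕ} {ρ : Fin k → ℝ} {x : ι → ℝ} {δ : ℝ} (hx0 : ∀ p, 0 < x p)
    (hx : ∀ i, ((A i).map (Nat.cast : ℕ → ℝ)).mulVec x = ρ i • x) (hδ : 0 < δ)
    (hdiam : ∀ η, stationaryWeight A ρ x δ η = diam (stationaryWeight A ρ x δ) η) :
    ∃ μ : Measure (stationaryBratteli A).InfPath, IsFiniteMeasure μ ∧
      ∀ τ : ChoiceFunction (stationaryWeight A ρ x δ),
        (∀ η, HasDixmierValue τ δ η (μ (cylinder η))) ∧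
        ∀ ν : Measure (stationaryBratteli A).InfPath, IsFiniteMeasure ν →
          (∀ η, HasDixmierValue τ δ η (ν (cylinder η))) → ν = μ := by
  rcases isEmpty_or_nonempty ι with hι | hι
  · exact ⟨0, inferInstance, fun τ => ⟨fun η => hι.elim η.2.root,
      fun ν _ _ => measure_ext_cylinder fun η => hι.elim η.2.root⟩⟩
  rcases isEmpty_or_nonempty (ChoiceFunction (stationaryWeight A ρ x δ)) with hτ | ⟨⟨τ₀⟩⟩
  · exact ⟨0, inferInstance, fun τ => hτ.elim τ⟩
  have hlevel (v : (stationaryBratteli A).FinPath 0) :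
      0 < diam (stationaryWeight A ρ x δ) ⟨0, v⟩ := by
    rw [← hdiam, stationaryWeight, levelProd, Finset.prod_range_zero, Real.one_rpow, one_mul]
    exact hx0 _
  have hρ := eigenvalue_pos_of_diam_pos hlevel hx0 hx
  have hR := one_lt_prod_eigenvalue_of_diam_pos hlevel hx0 hx
  obtain ⟨K, hK⟩ := exists_stationaryWeight_le (A := A) hρ hR.le hx0 hδ
  have hiff τ η t := hasDixmierValue_iff (fun γ => hdiam γ ▸ stationaryWeight_pos hρ hx0 γ)
    (fun γ => hdiam γ ▸ hK γ) hδ.le τ η t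
  choose t ht hlim using exists_tendsto_traceMeasure_cylinder hρ hx0 hδ hx hR hdiam
  obtain ⟨μ, hfinite, hμ⟩ := exists_measure_cylinder_eq τ₀ ht fun η => hlim η τ₀
  refine ⟨μ, hfinite, fun τ => ⟨fun η => (hiff τ η _).mpr (hμ η ▸ hlim η τ), fun ν _ hν => ?_⟩⟩
  refine measure_ext_cylinder fun η => ?_
  rw [hμ]
  exact tendsto_nhds_unique ((hiff τ η _).mp (hν η)) (hlim η τ)

theorem HigherRankGraph.weight_eq_stationaryWeight {k : ℕ} [NeZero k] {V : Type u} [Fintype V]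
    [DecidableEq V] [Category.{v} V] (Λ : HigherRankGraph k V) (δ : ℝ) :
    Λ.weight δ = stationaryWeight Λ.adj Λ.rho Λ.perron δ :=
  funext fun _ => congrArg (fun a => a ^ (-1 / δ) * Λ.perron _) (levelProd_eq_prod_pow _ _).symm

end

theorem proposition3p15 {k : ℕ} [NeZero k] {V : Type u} [Fintype V] [DecidableEq V]
    [Category.{v} V] (Λ : HigherRankGraph k V) (hfin : Λ.IsFinite)
    (hconn : Λ.StronglyConnected) (δ : ℝ) (hδ : δ ∈ Set.Ioo (0 : ℝ) 1)
    (hdiam : ∀ η : Λ.bratteli.Paths,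
      Λ.weight δ η = BratteliDiagram.diam (Λ.weight δ) η) :
    ∃ μ : Measure Λ.bratteli.InfPath, IsFiniteMeasure μ ∧
      ∀ τ : BratteliDiagram.ChoiceFunction (Λ.weight δ),
        (∀ η : Λ.bratteli.Paths,
          BratteliDiagram.HasDixmierValue τ δ η (μ (BratteliDiagram.cylinder η))) ∧
        ∀ ν : Measure Λ.bratteli.InfPath, IsFiniteMeasure ν →
          (∀ η : Λ.bratteli.Paths,
            BratteliDiagram.HasDixmierValue τ δ η (ν (BratteliDiagram.cylinder η))) →
          ν = μ := by
  rw [Λ.weight_eq_stationaryWeight] at hdiam ⊢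
  exact proposition3p15_general (HigherRankGraph.perron_pos hfin hconn)
    (HigherRankGraph.adj_mulVec_perron hfin hconn) hδ.1 hdiam
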